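/- A graph is a set $V$ of vertices with a reflexive symmetric relation $E\subseteq V^2$. A topological graph is a graph $(V,E)$ in which $V$ is a zero-dimensional compact second-countable Hausdorff space and $E$ is closed in $V^2$; finite graphs carry the discrete topology. A set $S$ of vertices is disconnected if $S=P\cup Q$ with $P,Q$ nonempty and closed in $S$ and with no edge between $P$ and $Q$; otherwise it is connected. A graph is called connected if $V$ is nonempty and connected. The component of $S$ containing $a\in S$ is the union of all connected subsets of $S$ that contain $a$. An epimorphism is a continuous map $f\colon G\to H$ of topological graphs that maps edges to edges and is surjective on vertices and on edges. It is confluent if $f(C)=Q$ for every connected set $Q$ of vertices of $H$ and every component $C$ of $f^{-1}(Q)$. Let $\mathcal G$ be the class of finite connected graphs with confluent epimorphisms. A projective Fraïssé limit of $\mathcal G$ is a topological graph $\mathbb G$ such that (1) for each $A\in\mathcal G$ there is a confluent epimorphism $\mathbb G\to A$; (2) for all $A,B\in\mathcal G$ and confluent epimorphisms $f\colon\mathbb G\to A$ and $g\colon B\to A$ there is a confluent epimorphism $h\colon\mathbb G\to B$ with $f=g\circ h$; (3) for every compatible metric on the vertex space of $\mathbb G$ and every $\varepsilon>0$ there are $A\in\mathcal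 G$ and a confluent epimorphism $f\colon\mathbb G\to A$ all of whose fibres have diameter less than $\varepsilon$. Theorem. A projective Fraïssé limit of $\mathcal G$ exists. For every such limit $\mathbb G$ the edge relation $E(\mathbb G)$ is transitive, hence an equivalence relation; the topological realization $|\mathbb G|=V(\mathbb G)/E(\mathbb G)$ with the quotient topology is a continuum (a nonempty compact connected metrizable space); and $|\mathbb G|$ is not homogeneous: there are points $x,y\in|\mathbb G|$ such that no homeomorphism of $|\mathbb G|$ onto itself maps $x$ to $y$. -/

import Mathlib

universe u v

/-- A graph on the vertex space `V`: a closed, reflexive and symmetric relation `Edge` on `V`.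
When `V` is compact, Hausdorff, totally disconnected (equivalently, for compact Hausdorff spaces,
zero-dimensional) and second countable, this is a topological graph. A finite graph is a graph on
a finite discrete space, where closedness of the edge relation is automatic. -/
structure TopGraph (V : Type u) [TopologicalSpace V] where
  Edge : V → V → Prop
  refl : ∀ a, Edge a a
  symm : ∀ a b, Edge a b → Edge b a
  closed : IsClosed {p : V × V | Edge p.1 p.2}

namespace TopGraph

variable {V : Type u} [TopologicalSpace V] {W : Type v} [TopologicalSpace W]

/-- A set `S` of vertices is disconnected if it is the union of two nonempty relatively closed
subsets with no edge between them. -/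
def DisconnectedSet (G : TopGraph V) (S : Set V) : Prop :=
  ∃ P Q : Set V, P.Nonempty ∧ Q.Nonempty ∧
    IsClosed ((↑) ⁻¹' P : Set S) ∧ IsClosed ((↑) ⁻¹' Q : Set S) ∧
    P ∪ Q = S ∧ ∀ a ∈ P, ∀ b ∈ Q, ¬ G.Edge a b

def ConnectedSet (G : TopGraph V) (S : Set V) : Prop := ¬ G.DisconnectedSet S

/-- A graph is connected if its (here: nonempty) set of vertices is connected. -/
def Connected (G : TopGraph V) : Prop := Nonempty V ∧ G.ConnectedSet Set.univ

/-- The component of `S` containing `a`. -/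
def component (G : TopGraph V) (S : Set V) (a : V) : Set V :=
  ⋃₀ {P : Set V | P ⊆ S ∧ a ∈ P ∧ G.ConnectedSet P}

/-- Epimorphisms: continuous maps that preserve edges and are onto on vertices and on edges. -/
structure IsEpi (G : TopGraph V) (H : TopGraph W) (f : V → W) : Prop where
  continuous : Continuous f
  map_edge : ∀ a b, G.Edge a b → H.Edge (f a) (f b)
  surjective : Function.Surjective f
  surjective_edge : ∀ c d, H.Edge c d → ∃ a b, G.Edge a b ∧ f a = c ∧ f b = d

/-- Confluent epimorphisms: every component of the preimage of a connected set `Q` is mapped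
onto `Q`. -/
structure IsConfluentEpi (G : TopGraph V) (H : TopGraph W) (f : V → W) : Prop
    extends IsEpi G H f where
  confluent : ∀ Q : Set W, H.ConnectedSet Q → ∀ a ∈ f ⁻¹' Q, f '' G.component (f ⁻¹' Q) a = Q

/-- The quotient space of `V` by the edge relation. It is the topological realization of `G` when
`Edge` is transitive; `Edge` is then an equivalence relation. -/
def Realization (G : TopGraph V) : Type u := Quot G.Edge

instance (G : TopGraph V) : TopologicalSpace G.Realization :=
  inferInstanceAs (TopologicalSpace (Quot G.Edge))

end TopGraph

/-- `f` is an `ε`-map with respect to the metric `m`: all fibres have diameter less than `ε`. -/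
def IsEpsMap {V : Type u} (m : MetricSpace V) {W : Type v} (ε : ℝ) (f : V → W) : Prop :=
  ∀ y : W, Metric.diam (f ⁻¹' {y}) < ε

/-- `G` is a projective Fraïssé limit of the class of finite connected graphs with confluent
epimorphisms: a topological graph which maps onto every member of the class, has the extension
property for confluent epimorphisms, and is approximated by members of the class. (The vertex space
is metrizable; by compactness the last condition does not depend on the compatible metric.) -/
structure IsConfluentFraisseLimit {V : Type u} [t : TopologicalSpace V] (G : TopGraph V) : Prop where
  compactSpace : CompactSpace V
  t2Space : T2Space V
  totallyDisconnectedSpace : TotallyDisconnectedSpace V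
  secondCountableTopology : SecondCountableTopology V
  projective_universal : ∀ (A : Type) [Finite A] [TopologicalSpace A] [DiscreteTopology A]
    (K : TopGraph A), K.Connected → ∃ f : V → A, G.IsConfluentEpi K f
  extension : ∀ (A B : Type) [Finite A] [TopologicalSpace A] [DiscreteTopology A]
    [Finite B] [TopologicalSpace B] [DiscreteTopology B] (K : TopGraph A) (L : TopGraph B),
    K.Connected → L.Connected → ∀ (f : V → A) (g : B → A),
    G.IsConfluentEpi K f → L.IsConfluentEpi K g → ∃ h : V → B, G.IsConfluentEpi L h ∧ f = g ∘ h
  approximation : ∀ m : MetricSpace V,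
    m.toPseudoMetricSpace.toUniformSpace.toTopologicalSpace = t →
    ∀ ε : ℝ, 0 < ε → ∃ (A : Type) (_ : Finite A) (_ : TopologicalSpace A)
      (_ : DiscreteTopology A) (K : TopGraph A) (f : V → A),
      K.Connected ∧ G.IsConfluentEpi K f ∧ IsEpsMap m ε f

/-- A continuum: a (nonempty) compact connected metrizable space. -/
def IsContinuum (X : Type u) [TopologicalSpace X] : Prop :=
  CompactSpace X ∧ ConnectedSpace X ∧ TopologicalSpace.MetrizableSpace X

def IsHomogeneousSpace (X : Type u) [TopologicalSpace X] : Prop :=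
  ∀ x y : X, ∃ h : X ≃ₜ X, h x = y

/-!
Finite connected graphs amalgamate: a component of the fibre product of two confluent epimorphisms
is confluent over both factors. A limit is therefore obtained as the inverse limit of a sequence in
which every extension problem that is posed at some stage is solved at a later one.

For transitivity, a path `a, b, c` without an edge from `a` to `c` would remain a path of length two
in some finite quotient, and lifting this quotient to its subdivision would move `b` away from
itself.

For non-homogeneity, cut the realization into two closed pieces `P` and `Q` that meet in disjoint
closed sets `M` and `N`, and think of a flow which runs from `P` through `M` to `Q` and through `N`
back to `P`. Whether the flow returns to a point of `N` can be expressed by relatively clopen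
subsets of `P` and `Q`, so that this recurrence is a topological property of the point. A cut with
recurrent points comes from a confluent epimorphism onto a cycle of length four, by compactness. On
the other hand, by Baire category there is a vertex which can be sent to any admissible vertex in
every extension problem. Its class is not recurrent for any cut, since the flow can be unwound in a
two-sheeted cover of a finite quotient, and the vertex can be sent to the passage between the
sheets.
-/

open Set Relation Topology

/-- `S` is relatively clopen in the subspace `P`. Only the trace `P ∩ S` matters: `S` is not
required to be a subset of `P`. -/
def IsClopenOn {X : Type*} [TopologicalSpace X] (S P : Set X) : Prop :=
  IsClopen ((↑) ⁻¹' S : Set P)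

namespace IsClopenOn

variable {X Y : Type*} [TopologicalSpace X] [TopologicalSpace Y] {S P : Set X}

theorem preimage {f : Y → X} {P' : Set Y} (hS : IsClopenOn S P) (hf : ContinuousOn f P')
    (hP : MapsTo f P' P) : IsClopenOn (f ⁻¹' S) P' :=
  IsClopen.preimage hS (hf.mapsToRestrict hP)

theorem mono {P' : Set X} (hS : IsClopenOn S P) (hP : P' ⊆ P) : IsClopenOn S P' :=
  hS.preimage continuousOn_id hP

theorem compl (hS : IsClopenOn S P) : IsClopenOn Sᶜ P :=
  IsClopen.compl hS

theorem biInter_finite {ι : Type*} {T : Set ι} (hT : T.Finite) {S : ι → Set X}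
    (hS : ∀ i ∈ T, IsClopenOn (S i) P) : IsClopenOn (⋂ i ∈ T, S i) P := by
  simpa only [IsClopenOn, preimage_iInter] using hT.isClopen_biInter hS

theorem forall_mem_iff {ι : Type*} {T : Set ι} (hT : T.Finite) {S : ι → Set X}
    (hS : ∀ i ∈ T, IsClopenOn (S i) P) (x : X) :
    IsClopenOn {y | ∀ i ∈ T, (y ∈ S i ↔ x ∈ S i)} P := by
  simp only [ofPred_forall]
  refine biInter_finite hT fun i hi => ?_
  by_cases hx : x ∈ S i
  · simpa [hx] using hS i hi
  · simpa [hx, compl_def] using (hS i hi).compl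

end IsClopenOn

theorem isClopenOn_iff {X : Type*} [TopologicalSpace X] {S P : Set X} (hP : IsClosed P) :
    IsClopenOn S P ↔ IsClosed (P ∩ S) ∧ IsClosed (P \ S) := by
  simp only [IsClopenOn, IsClopen, ← isClosed_compl_iff (s := Subtype.val ⁻¹' S),
    hP.isClosedEmbedding_subtypeVal.isClosed_iff_image_isClosed, ← preimage_compl,
    Subtype.image_preimage_coe, Set.sdiff_eq]

theorem IsClopenOn.isClopen_inter {X : Type*} [TopologicalSpace X] {S D : Set X}
    (hS : IsClopenOn S D) (hD : IsClopen D) : IsClopen (S ∩ D) := by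
  obtain ⟨hinter, hdiff⟩ := (isClopenOn_iff hD.isClosed).1 hS
  refine ⟨inter_comm D S ▸ hinter, isClosed_compl_iff.1 ?_⟩
  have hcompl : (S ∩ D)ᶜ = Dᶜ ∪ D \ S := by
    ext x
    by_cases hx : x ∈ D <;> simp [hx]
  exact hcompl ▸ hD.compl.isClosed.union hdiff

namespace TopGraph

variable {V : Type*} [TopologicalSpace V] {W : Type*} [TopologicalSpace W]
  {X : Type*} [TopologicalSpace X]

section ConnectedSet

variable {G : TopGraph V} {H : TopGraph W} {S : Set V}

theorem connectedSet_iff : G.ConnectedSet S ↔ ∀ U, IsClopenOn U S →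
    (∀ a ∈ S ∩ U, ∀ b ∈ S, G.Edge a b → b ∈ U) → (S ∩ U).Nonempty → S ⊆ U := by
  constructor
  · intro hS U hU hE hne
    by_contra hSU
    obtain ⟨x, hxS, hxU⟩ := not_subset.1 hSU
    refine hS ⟨S ∩ U, S \ U, hne, ⟨x, hxS, hxU⟩, ?_, ?_, inter_union_sdiff S U, ?_⟩
    · simpa using hU.isClosed
    · simpa [sdiff_eq] using hU.compl.isClosed
    · exact fun a ha b hb hab => hb.2 (hE a ha b hb.1 hab)
  · rintro h ⟨P, Q, ⟨p, hp⟩, ⟨q, hq⟩, hP, hQ, rfl, hPQ⟩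
    have hcompl : ((↑) ⁻¹' P : Set ↥(P ∪ Q))ᶜ = (↑) ⁻¹' Q := by
      ext ⟨x, hx⟩
      exact ⟨hx.resolve_left, fun hxQ hxP => hPQ x hxP x hxQ (G.refl x)⟩
    refine hPQ q (h P ⟨hP, ?_⟩ ?_ ⟨p, Or.inl hp, hp⟩ (Or.inr hq)) q hq (G.refl q)
    · rwa [← isClosed_compl_iff, hcompl]
    · exact fun a ha b hb hab => hb.resolve_right fun hbQ => hPQ a ha.2 b hbQ hab

theorem ConnectedSet.subset_of_isClopenOn {U : Set V} (hS : G.ConnectedSet S)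
    (hU : IsClopenOn U S) (hE : ∀ a ∈ S ∩ U, ∀ b ∈ S, G.Edge a b → b ∈ U)
    (hne : (S ∩ U).Nonempty) : S ⊆ U :=
  connectedSet_iff.1 hS U hU hE hne

theorem ConnectedSet.image (hS : G.ConnectedSet S) {f : V → W} (hf : Continuous f)
    (hE : ∀ a b, G.Edge a b → H.Edge (f a) (f b)) : H.ConnectedSet (f '' S) := by
  refine connectedSet_iff.2 fun U hU hUE => ?_
  rintro ⟨_, ⟨a, haS, rfl⟩, haU⟩
  refine image_subset_iff.2 (hS.subset_of_isClopenOn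
    (hU.preimage hf.continuousOn (mapsTo_image f S)) ?_ ⟨a, haS, haU⟩)
  exact fun x hx y hy hxy =>
    hUE _ ⟨mem_image_of_mem f hx.1, hx.2⟩ _ (mem_image_of_mem f hy) (hE x y hxy)

theorem connectedSet_singleton (G : TopGraph V) (a : V) : G.ConnectedSet {a} :=
  connectedSet_iff.2 fun _ _ _ hne => by simpa using hne

theorem ConnectedSet.sUnion {𝒮 : Set (Set V)} {a : V}
    (h : ∀ S ∈ 𝒮, a ∈ S ∧ G.ConnectedSet S) : G.ConnectedSet (⋃₀ 𝒮) := by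
  refine connectedSet_iff.2 fun U hU hE => ?_
  have hsub : ∀ S ∈ 𝒮, (S ∩ U).Nonempty → S ⊆ U := fun S hS =>
    (h S hS).2.subset_of_isClopenOn (hU.mono (subset_sUnion_of_mem hS))
      fun x hx y hy => hE x ⟨⟨S, hS, hx.1⟩, hx.2⟩ y ⟨S, hS, hy⟩
  rintro ⟨b, ⟨S, hS, hbS⟩, hbU⟩
  have haU : a ∈ U := hsub S hS ⟨b, hbS, hbU⟩ (h S hS).1
  exact sUnion_subset fun T hT => hsub T hT ⟨a, (h T hT).1, haU⟩

theorem connectedSet_component (G : TopGraph V) (S : Set V) (a : V) :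
    G.ConnectedSet (G.component S a) :=
  ConnectedSet.sUnion (a := a) fun _ hP => hP.2

theorem component_subset (G : TopGraph V) (S : Set V) (a : V) : G.component S a ⊆ S :=
  sUnion_subset fun _ hP => hP.1

theorem mem_component_self (G : TopGraph V) {a : V} (ha : a ∈ S) : a ∈ G.component S a :=
  ⟨{a}, ⟨by simpa, rfl, G.connectedSet_singleton a⟩, rfl⟩

theorem ConnectedSet.subset_component {P : Set V} {a : V} (hP : G.ConnectedSet P) (hPS : P ⊆ S)
    (ha : a ∈ P) : P ⊆ G.component S a :=
  subset_sUnion_of_mem ⟨hPS, ha, hP⟩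

theorem Connected.of_isEpi {f : V → W} (hG : G.Connected) (hf : G.IsEpi H f) : H.Connected := by
  refine ⟨hG.1.map f, ?_⟩
  simpa only [image_univ, hf.surjective.range_eq] using hG.2.image hf.continuous hf.map_edge

end ConnectedSet

section Epimorphisms

variable {G : TopGraph V} {H : TopGraph W} {K : TopGraph X} {f : V → W} {g : W → X}

theorem IsEpi.comp (hg : H.IsEpi K g) (hf : G.IsEpi H f) : G.IsEpi K (g ∘ f) where
  continuous := hg.continuous.comp hf.continuous
  map_edge a b h := hg.map_edge _ _ (hf.map_edge a b h)
  surjective := hg.surjective.comp hf.surjective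
  surjective_edge c d h := by
    obtain ⟨a, b, hab, rfl, rfl⟩ := hg.surjective_edge c d h
    obtain ⟨a', b', hab', rfl, rfl⟩ := hf.surjective_edge a b hab
    exact ⟨a', b', hab', rfl, rfl⟩

theorem image_component_subset (hf : Continuous f) (hE : ∀ a b, G.Edge a b → H.Edge (f a) (f b))
    {Q : Set W} {a : V} (ha : f a ∈ Q) : f '' G.component (f ⁻¹' Q) a ⊆ H.component Q (f a) :=
  ((G.connectedSet_component _ a).image hf hE).subset_component
    (image_subset_iff.2 (G.component_subset _ a)) (mem_image_of_mem f (G.mem_component_self ha))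

theorem IsConfluentEpi.image_component (hf : G.IsConfluentEpi H f) {Q : Set W} {a : V}
    (ha : f a ∈ Q) : f '' G.component (f ⁻¹' Q) a = H.component Q (f a) := by
  refine Subset.antisymm (image_component_subset hf.continuous hf.map_edge ha) ?_
  have haC : a ∈ f ⁻¹' H.component Q (f a) := H.mem_component_self ha
  rw [← hf.confluent _ (H.connectedSet_component Q (f a)) a haC]
  refine image_mono ((G.connectedSet_component _ a).subset_component ?_ (G.mem_component_self haC))
  exact (G.component_subset _ a).trans (preimage_mono (H.component_subset Q (f a)))

theorem IsConfluentEpi.comp (hg : H.IsConfluentEpi K g) (hf : G.IsConfluentEpi H f) :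
    G.IsConfluentEpi K (g ∘ f) where
  toIsEpi := hg.toIsEpi.comp hf.toIsEpi
  confluent Q hQ a ha := by
    rw [image_comp, preimage_comp, hf.image_component ha, hg.confluent Q hQ (f a) ha]

theorem IsConfluentEpi.of_comp (hg : Continuous g) (hgf : G.IsConfluentEpi K (g ∘ f))
    (hf : G.IsEpi H f) : H.IsConfluentEpi K g where
  continuous := hg
  map_edge c d h := by
    obtain ⟨a, b, hab, rfl, rfl⟩ := hf.surjective_edge c d h
    exact hgf.map_edge a b hab
  surjective := hgf.surjective.of_comp
  surjective_edge c d h := by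
    obtain ⟨a, b, hab, rfl, rfl⟩ := hgf.surjective_edge c d h
    exact ⟨f a, f b, hf.map_edge _ _ hab, rfl, rfl⟩
  confluent Q hQ b hb := by
    obtain ⟨a, rfl⟩ := hf.surjective b
    refine Subset.antisymm (image_subset_iff.2 (H.component_subset _ _)) ?_
    calc Q = g '' (f '' G.component (f ⁻¹' (g ⁻¹' Q)) a) := by
          rw [← image_comp, ← preimage_comp, hgf.confluent Q hQ a hb]
      _ ⊆ g '' H.component (g ⁻¹' Q) (f a) :=
          image_mono (image_component_subset hf.continuous hf.map_edge hb)

end Epimorphisms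

section Reach

/-- `G.Reach S a b` says that there is a walk from `a` to `b` all of whose vertices after `a` lie
in `S`. -/
def Reach (G : TopGraph V) (S : Set V) : V → V → Prop :=
  ReflTransGen fun a b => G.Edge a b ∧ b ∈ S

namespace Reach

variable {G : TopGraph V} {S T : Set V} {a b c : V}

theorem mono (hab : G.Reach S a b) (h : S ⊆ T) : G.Reach T a b :=
  ReflTransGen.mono (fun _ _ h' => ⟨h'.1, h h'.2⟩) _ _ hab

theorem mem (hab : G.Reach S a b) (ha : a ∈ S) : b ∈ S := by
  induction hab with
  | refl => exact ha
  | tail _ h _ => exact h.2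

theorem symm (hab : G.Reach S a b) (ha : a ∈ S) : G.Reach S b a := by
  induction hab with
  | refl => exact ReflTransGen.refl
  | tail hax hxy ih => exact ReflTransGen.head ⟨G.symm _ _ hxy.1, Reach.mem hax ha⟩ ih

theorem mem_of_edge_closed {U : Set V} (hab : G.Reach S a b)
    (hU : ∀ x ∈ U, ∀ y ∈ S, G.Edge x y → y ∈ U) (ha : a ∈ U) : b ∈ U := by
  induction hab with
  | refl => exact ha
  | tail _ hxy ih => exact hU _ ih _ hxy.2 hxy.1

end Reach

variable {G : TopGraph V} {S : Set V}

theorem connectedSet_of_forall_reach {a : V} (ha : a ∈ S) (h : ∀ b ∈ S, G.Reach S a b) :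
    G.ConnectedSet S := by
  refine connectedSet_iff.2 fun U _ hE => ?_
  rintro ⟨c, hcS, hcU⟩ b hb
  have hcb : G.Reach S c b := ((h c hcS).symm ha).trans (h b hb)
  exact (hcb.mem_of_edge_closed (U := S ∩ U) (fun x hx y hy hxy => ⟨hy, hE x hx y hy hxy⟩)
    ⟨hcS, hcU⟩).2

theorem connectedSet_pair {a b : V} (hab : G.Edge a b) : G.ConnectedSet {a, b} := by
  refine connectedSet_of_forall_reach (a := a) (Or.inl rfl) ?_
  rintro _ (rfl | rfl)
  exacts [ReflTransGen.refl, ReflTransGen.single ⟨hab, Or.inr rfl⟩]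

theorem connected_of_forall_reach {a : V} (h : ∀ b, G.Reach univ a b) : G.Connected :=
  ⟨⟨a⟩, connectedSet_of_forall_reach (mem_univ a) fun b _ => h b⟩

variable [DiscreteTopology V]

theorem ConnectedSet.reach (hS : G.ConnectedSet S) {a b : V} (ha : a ∈ S) (hb : b ∈ S) :
    G.Reach S a b :=
  hS.subset_of_isClopenOn (U := {v | G.Reach S a v}) (isClopen_discrete _)
    (fun _ hx _ hy hxy => hx.2.tail ⟨hxy, hy⟩) ⟨a, ha, ReflTransGen.refl⟩ hb

theorem mem_component_iff_reach {a b : V} (ha : a ∈ S) :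
    b ∈ G.component S a ↔ G.Reach S a b := by
  constructor
  · rintro ⟨P, ⟨hPS, haP, hP⟩, hb⟩
    exact (hP.reach haP hb).mono hPS
  · intro hab
    have hconn : G.ConnectedSet {v | G.Reach S a v} := by
      refine connectedSet_of_forall_reach (a := a) ReflTransGen.refl fun v hv => ?_
      induction hv with
      | refl => exact ReflTransGen.refl
      | tail hax hxy ih => exact ih.tail ⟨hxy.1, hax.tail hxy⟩
    exact hconn.subset_component (fun v hv => hv.mem ha) ReflTransGen.refl hab

end Reach

section LiftsEdges

variable {G : TopGraph V} {H : TopGraph W} {f : V → W}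

/-- The edge-lifting property: every edge from `f a` to `d` is covered by a walk which starts at
`a`, stays over the two endpoints and ends over `d`. Onto discrete connected graphs, the maps of
discrete graphs with this property that preserve edges are the confluent epimorphisms. -/
def LiftsEdges (G : TopGraph V) (H : TopGraph W) (f : V → W) : Prop :=
  ∀ a d, H.Edge (f a) d → ∃ b, G.Reach (f ⁻¹' {f a, d}) a b ∧ f b = d

theorem IsConfluentEpi.liftsEdges [DiscreteTopology V] (hf : G.IsConfluentEpi H f) :
    G.LiftsEdges H f := by
  intro a d had
  have ha : a ∈ f ⁻¹' {f a, d} := Or.inl rfl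
  obtain ⟨b, hb, hbd⟩ := (hf.confluent _ (connectedSet_pair had) a ha).ge (Or.inr rfl)
  exact ⟨b, (mem_component_iff_reach ha).1 hb, hbd⟩

theorem LiftsEdges.lift_reach (hf : G.LiftsEdges H f) {Q : Set W} {a : V} (ha : f a ∈ Q) {d : W}
    (had : H.Reach Q (f a) d) : ∃ b, G.Reach (f ⁻¹' Q) a b ∧ f b = d := by
  induction had with
  | refl => exact ⟨a, ReflTransGen.refl, rfl⟩
  | tail _ hcd ih =>
    obtain ⟨b, hab, rfl⟩ := ih
    obtain ⟨c, hbc, rfl⟩ := hf b _ hcd.1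
    exact ⟨c, hab.trans (hbc.mono (preimage_mono (pair_subset (hab.mem ha) hcd.2))), rfl⟩

theorem LiftsEdges.exists_edge (hf : G.LiftsEdges H f) {a : V} {d : W} (had : H.Edge (f a) d) :
    ∃ x y, G.Edge x y ∧ f x = f a ∧ f y = d := by
  obtain ⟨b, hab, rfl⟩ := hf a d had
  by_contra! hne
  have hba : f b = f a := by
    refine hab.mem_of_edge_closed (U := {x | f x = f a}) (fun x hx y hy hxy => ?_) rfl
    exact hy.resolve_right (hne x y hxy hx)
  exact hne b b (G.refl b) hba rfl

theorem LiftsEdges.isConfluentEpi [DiscreteTopology V] [DiscreteTopology W] [Nonempty V]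
    (hf : G.LiftsEdges H f) (hH : H.Connected)
    (hE : ∀ a b, G.Edge a b → H.Edge (f a) (f b)) : G.IsConfluentEpi H f := by
  have hs : Function.Surjective f := fun d => by
    obtain ⟨a⟩ := ‹Nonempty V›
    obtain ⟨b, -, hb⟩ := hf.lift_reach (mem_univ _) (hH.2.reach (mem_univ (f a)) (mem_univ d))
    exact ⟨b, hb⟩
  refine ⟨⟨continuous_of_discreteTopology, hE, hs, fun c d hcd => ?_⟩, fun Q hQ a ha => ?_⟩
  · obtain ⟨a, rfl⟩ := hs c
    exact hf.exists_edge hcd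
  · refine Subset.antisymm (image_subset_iff.2 (G.component_subset _ _)) fun d hd => ?_
    obtain ⟨b, hab, rfl⟩ := hf.lift_reach ha (hQ.reach ha hd)
    exact ⟨b, (mem_component_iff_reach ha).2 hab, rfl⟩

end LiftsEdges

section Amalgamation

theorem Reach.map {G : TopGraph V} {H : TopGraph W} {f : V → W}
    (hf : ∀ a b, G.Edge a b → H.Edge (f a) (f b)) {S : Set V} {T : Set W} (hST : MapsTo f S T)
    {a b : V} (hab : G.Reach S a b) : H.Reach T (f a) (f b) :=
  ReflTransGen.lift f (fun _ _ h => ⟨hf _ _ h.1, hST h.2⟩) _ _ hab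

/-- The subgraph induced on a set of vertices. -/
def induce (G : TopGraph V) (S : Set V) : TopGraph S where
  Edge a b := G.Edge a b
  refl a := G.refl a
  symm a b := G.symm a b
  closed := G.closed.preimage (continuous_subtype_val.prodMap continuous_subtype_val)

theorem Reach.induce {G : TopGraph V} {S T : Set V} (hS : ∀ a ∈ S, ∀ b, G.Edge a b → b ∈ S)
    {a b : V} (ha : a ∈ S) (hab : G.Reach T a b) :
    ∃ hb : b ∈ S, (G.induce S).Reach ((↑) ⁻¹' T) ⟨a, ha⟩ ⟨b, hb⟩ := by
  induction hab with
  | refl => exact ⟨ha, ReflTransGen.refl⟩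
  | tail _ hxy ih =>
    obtain ⟨hx, hax⟩ := ih
    exact ⟨hS _ hx _ hxy.1, hax.tail hxy⟩

theorem LiftsEdges.induce {G : TopGraph V} {H : TopGraph W} {f : V → W} (hf : G.LiftsEdges H f)
    {S : Set V} (hS : ∀ a ∈ S, ∀ b, G.Edge a b → b ∈ S) :
    (G.induce S).LiftsEdges H (fun x => f x) := by
  rintro ⟨a, ha⟩ d had
  obtain ⟨b, hab, hbd⟩ := hf a d had
  obtain ⟨hb, hab'⟩ := hab.induce hS ha
  exact ⟨⟨b, hb⟩, hab', hbd⟩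

variable {A : Type*} {B : Type u} {C : Type v} [TopologicalSpace A] [TopologicalSpace B]
  [TopologicalSpace C]

/-- The fibre product of two graphs over a set of vertices. -/
def pullback (L : TopGraph B) (M : TopGraph C) (f : B → A) (g : C → A) :
    TopGraph {x : B × C // f x.1 = g x.2} where
  Edge x y := L.Edge x.1.1 y.1.1 ∧ M.Edge x.1.2 y.1.2
  refl x := ⟨L.refl _, M.refl _⟩
  symm x y h := ⟨L.symm _ _ h.1, M.symm _ _ h.2⟩
  closed :=
    have hfst : Continuous fun x : {x : B × C // f x.1 = g x.2} => x.1.1 := by fun_prop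
    have hsnd : Continuous fun x : {x : B × C // f x.1 = g x.2} => x.1.2 := by fun_prop
    (L.closed.preimage (hfst.prodMap hfst)).inter (M.closed.preimage (hsnd.prodMap hsnd))

variable {K : TopGraph A} {L : TopGraph B} {M : TopGraph C} {f : B → A} {g : C → A}

theorem liftsEdges_pullback_fst (hf : ∀ a b, L.Edge a b → K.Edge (f a) (f b))
    (hg : M.LiftsEdges K g) : (pullback L M f g).LiftsEdges L fun x => x.1.1 := by
  rintro ⟨⟨b, c⟩, hbc : f b = g c⟩ b' (hb' : L.Edge b b')
  obtain ⟨c', hcc', hc'⟩ := hg c (f b') (hbc ▸ hf b b' hb')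
  have hedge : ∀ e ∈ ({b, b'} : Set B), ∀ e' ∈ ({b, b'} : Set B), L.Edge e e' := by
    rintro e (rfl | rfl) e' (rfl | rfl)
    exacts [L.refl _, hb', L.symm _ _ hb', L.refl _]
  have hlift : ∀ z, M.Reach (g ⁻¹' {g c, f b'}) c z → ∀ e ∈ ({b, b'} : Set B), ∀ h : f e = g z,
      (pullback L M f g).Reach ((fun x => x.1.1) ⁻¹' {b, b'}) ⟨(b, c), hbc⟩ ⟨(e, z), h⟩ := by
    intro z hz
    induction hz with
    | refl => exact fun e he h => ReflTransGen.single ⟨⟨hedge b (Or.inl rfl) e he, M.refl c⟩, he⟩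
    | @tail z w hcz hzw ih =>
      intro e he h
      obtain ⟨e', he', hez⟩ : ∃ e' ∈ ({b, b'} : Set B), f e' = g z :=
        (Reach.mem hcz (Or.inl rfl)).elim (fun h => ⟨b, Or.inl rfl, hbc.trans h.symm⟩)
          fun h => ⟨b', Or.inr rfl, Eq.symm h⟩
      exact (ih e' he' hez).tail ⟨⟨hedge e' he' e he, hzw.1⟩, he⟩
  exact ⟨⟨(b', c'), hc'.symm⟩, hlift c' hcc' b' (Or.inr rfl) hc'.symm, rfl⟩

theorem liftsEdges_pullback_snd (hf : L.LiftsEdges K f)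
    (hg : ∀ a b, M.Edge a b → K.Edge (g a) (g b)) :
    (pullback L M f g).LiftsEdges M fun x => x.1.2 := by
  intro x c hc
  let swap (z : {z : C × B // g z.1 = f z.2}) : {z : B × C // f z.1 = g z.2} :=
    ⟨z.1.swap, z.2.symm⟩
  obtain ⟨y, hxy, hy⟩ := liftsEdges_pullback_fst hg hf ⟨x.1.swap, x.2.symm⟩ c hc
  have hwalk := hxy.map (H := pullback L M f g) (f := swap)
    (T := (fun z => z.1.2) ⁻¹' {x.1.2, c}) (fun _ _ h => And.symm h) fun _ h => h
  exact ⟨swap y, hwalk, hy⟩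

theorem exists_amalgam [DiscreteTopology B] [Finite B] [DiscreteTopology C] [Finite C]
    (hL : L.Connected) (hM : M.Connected) (hf : L.IsConfluentEpi K f)
    (hg : M.IsConfluentEpi K g) {b : B} {c : C} (hbc : f b = g c) :
    ∃ (D : Type (max u v)) (_ : Finite D) (_ : TopologicalSpace D) (_ : DiscreteTopology D)
      (N : TopGraph D) (p : D → B) (q : D → C) (d : D), N.Connected ∧ N.IsConfluentEpi L p ∧
      N.IsConfluentEpi M q ∧ f ∘ p = g ∘ q ∧ p d = b ∧ q d = c := by
  let P := pullback L M f g
  let d : {x : B × C // f x.1 = g x.2} := ⟨(b, c), hbc⟩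
  let S : Set {x : B × C // f x.1 = g x.2} := {x | P.Reach univ d x}
  have hS : ∀ x ∈ S, ∀ y, P.Edge x y → y ∈ S := fun x hx y hxy => hx.tail ⟨hxy, mem_univ y⟩
  have hd : d ∈ S := ReflTransGen.refl
  have hconn : (P.induce S).Connected :=
    connected_of_forall_reach (a := ⟨d, hd⟩) fun x => (x.2.induce hS hd).2
  have : Nonempty S := hconn.1
  exact ⟨S, inferInstance, inferInstance, inferInstance, P.induce S, _, _, ⟨d, hd⟩, hconn,
    ((liftsEdges_pullback_fst hf.map_edge hg.liftsEdges).induce hS).isConfluentEpi hL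
      fun _ _ h => h.1,
    ((liftsEdges_pullback_snd hf.liftsEdges hg.map_edge).induce hS).isConfluentEpi hM
      fun _ _ h => h.2,
    funext fun x => x.1.2, rfl, rfl⟩

end Amalgamation

end TopGraph

section ProperMap

variable {X Y : Type*} [TopologicalSpace X] [TopologicalSpace Y] {f : X → Y}

theorem t2Space_of_isProperMap [T2Space X] (hf : IsProperMap f) (hs : Function.Surjective f) :
    T2Space Y := by
  have himage : Prod.map f f '' diagonal X = diagonal Y := by
    ext ⟨y, z⟩
    constructor
    · rintro ⟨⟨a, b⟩, rfl : a = b, h⟩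
      exact congrArg Prod.fst h.symm |>.trans (congrArg Prod.snd h)
    · rintro (rfl : y = z)
      obtain ⟨x, rfl⟩ := hs y
      exact ⟨(x, x), rfl, rfl⟩
  rw [t2_iff_isClosed_diagonal, ← himage]
  exact (hf.prodMap hf).isClosedMap _ isClosed_diagonal

theorem secondCountableTopology_of_isProperMap [SecondCountableTopology X] (hf : IsProperMap f)
    (hs : Function.Surjective f) : SecondCountableTopology Y := by
  let B := TopologicalSpace.countableBasis X
  have hB : TopologicalSpace.IsTopologicalBasis B := TopologicalSpace.isBasis_countableBasis X
  have hbasis : TopologicalSpace.IsTopologicalBasis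
      ((fun T => kernImage f (⋃₀ T)) '' {T : Set (Set X) | T.Finite ∧ T ⊆ B}) := by
    refine TopologicalSpace.isTopologicalBasis_of_isOpen_of_nhds ?_ fun y U hyU hU => ?_
    · rintro _ ⟨T, hT, rfl⟩
      exact isClosedMap_iff_kernImage.1 hf.isClosedMap
        (isOpen_sUnion fun t ht => hB.isOpen (hT.2 ht))
    · obtain ⟨T, hTB, hT, hyT⟩ :=
        (hf.isCompact_preimage (isCompact_singleton (x := y))).elim_finite_subcover_image
        (b := {t ∈ B | t ⊆ f ⁻¹' U}) (c := id) (fun t ht => hB.isOpen ht.1) fun x hx => by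
          obtain ⟨t, htB, hxt, htU⟩ := hB.exists_subset_of_mem_open
            (show x ∈ f ⁻¹' U from mem_preimage.2 (hx ▸ hyU)) (hU.preimage hf.continuous)
          exact mem_biUnion (x := t) ⟨htB, htU⟩ hxt
      refine ⟨_, ⟨T, ⟨hT, fun t ht => (hTB ht).1⟩, rfl⟩, fun x hx => ?_, fun z hz => ?_⟩
      · simpa [sUnion_eq_biUnion] using hyT hx
      · obtain ⟨x, rfl⟩ := hs z
        obtain ⟨t, htT, hxt⟩ := hz rfl
        exact (hTB htT).2 hxt
  exact hbasis.secondCountableTopology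
    ((countable_ofPred_finite_subset (TopologicalSpace.countable_countableBasis X)).image _)

end ProperMap

namespace TopGraph

section Realization

variable {V : Type*} [TopologicalSpace V] {G : TopGraph V}

/-- The quotient map onto the topological realization. -/
def toRealization (G : TopGraph V) : V → G.Realization := Quot.mk _

theorem continuous_toRealization (G : TopGraph V) : Continuous G.toRealization :=
  continuous_quot_mk

theorem surjective_toRealization (G : TopGraph V) : Function.Surjective G.toRealization :=
  Quot.mk_surjective

theorem toRealization_eq_of_edge {a b : V} (hab : G.Edge a b) :
    G.toRealization a = G.toRealization b :=
  Quot.sound hab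

theorem toRealization_eq_iff (hG : ∀ a b c, G.Edge a b → G.Edge b c → G.Edge a c) {a b : V} :
    G.toRealization a = G.toRealization b ↔ G.Edge a b :=
  Quot.eq.trans (Equivalence.eqvGen_iff ⟨G.refl, G.symm _ _, hG _ _ _⟩)

theorem isProperMap_toRealization [CompactSpace V]
    (hG : ∀ a b c, G.Edge a b → G.Edge b c → G.Edge a c) : IsProperMap G.toRealization := by
  have hsat : ∀ C : Set V, G.toRealization ⁻¹' (G.toRealization '' C) =
      Prod.snd '' ({p : V × V | G.Edge p.1 p.2} ∩ Prod.fst ⁻¹' C) := by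
    intro C
    ext b
    simp [toRealization_eq_iff hG, and_comm]
  have hclosed : IsClosedMap G.toRealization := fun C hC => by
    have hq : IsQuotientMap G.toRealization := isQuotientMap_quot_mk
    rw [← hq.isClosed_preimage, hsat]
    exact isClosedMap_snd_of_compactSpace _ (G.closed.inter (hC.preimage continuous_fst))
  refine isProperMap_iff_isClosedMap_and_compact_fibers.2
    ⟨G.continuous_toRealization, hclosed, fun q => ?_⟩
  obtain ⟨a, rfl⟩ := G.surjective_toRealization q
  have hfibre : G.toRealization ⁻¹' {G.toRealization a} = {b | G.Edge b a} := by
    ext b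
    exact toRealization_eq_iff hG
  rw [hfibre]
  exact (G.closed.preimage (continuous_id.prodMk continuous_const)).isCompact

theorem Connected.connectedSpace_realization (hG : G.Connected) :
    ConnectedSpace G.Realization := by
  have hpre : PreconnectedSpace G.Realization := by
    refine preconnectedSpace_iff_clopen.2 fun S hS => ?_
    refine S.eq_empty_or_nonempty.imp_right fun ⟨q, hq⟩ => ?_
    obtain ⟨x, rfl⟩ := G.surjective_toRealization q
    have hcover : univ ⊆ G.toRealization ⁻¹' S := by
      refine hG.2.subset_of_isClopenOn ?_ ?_ ⟨x, mem_univ x, hq⟩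
      · exact (hS.preimage G.continuous_toRealization).preimage continuous_subtype_val
      · intro a ha b _ hab
        exact (toRealization_eq_of_edge hab ▸ ha.2 : G.toRealization b ∈ S)
    refine eq_univ_of_forall fun q => ?_
    obtain ⟨y, rfl⟩ := G.surjective_toRealization q
    exact hcover (mem_univ y)
  exact { toPreconnectedSpace := hpre, toNonempty := hG.1.map G.toRealization }

end Realization

section Subdivision

variable {A : Type*} [TopologicalSpace A] [DiscreteTopology A] {K : TopGraph A}

/-- The subdivision of a graph: `(a, a)` is the vertex `a`, and `(a, b)` with
`a ≠ b` is the half of the edge between `a` and `b` that is adjacent to `a`. -/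
def subdivision (K : TopGraph A) : TopGraph {p : A × A // K.Edge p.1 p.2} where
  Edge p q := p = q ∨ (p.1.1 = q.1.1 ∧ (p.1.1 = p.1.2 ∨ q.1.1 = q.1.2)) ∨
    (p.1.1 = q.1.2 ∧ p.1.2 = q.1.1)
  refl p := Or.inl rfl
  symm p q := by
    rintro (h | ⟨h, h'⟩ | ⟨h, h'⟩)
    exacts [Or.inl h.symm, Or.inr (Or.inl ⟨h.symm, h'.symm⟩), Or.inr (Or.inr ⟨h'.symm, h.symm⟩)]
  closed := isClosed_discrete _

theorem subdivision_edge_of_fst_ne {p q : {p : A × A // K.Edge p.1 p.2}}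
    (hpq : K.subdivision.Edge p q) (hne : p.1.1 ≠ q.1.1) : p.1.1 = q.1.2 ∧ p.1.2 = q.1.1 := by
  rcases hpq with rfl | h | h
  exacts [absurd rfl hne, absurd h.1 hne, h]

theorem liftsEdges_subdivision_fst (K : TopGraph A) :
    K.subdivision.LiftsEdges K fun p => p.1.1 := by
  rintro ⟨⟨a, b⟩, hab⟩ c (hac : K.Edge a c)
  have hwalk : K.subdivision.Reach ((fun p => p.1.1) ⁻¹' {a, c}) ⟨(a, b), hab⟩
      ⟨(c, a), K.symm _ _ hac⟩ :=
    ((ReflTransGen.single (b := ⟨(a, a), K.refl a⟩)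
      ⟨Or.inr (Or.inl ⟨rfl, Or.inr rfl⟩), Or.inl rfl⟩).tail (c := ⟨(a, c), hac⟩)
      ⟨Or.inr (Or.inl ⟨rfl, Or.inl rfl⟩), Or.inl rfl⟩).tail ⟨Or.inr (Or.inr ⟨rfl, rfl⟩), Or.inr rfl⟩
  exact ⟨_, hwalk, rfl⟩

theorem Connected.subdivision (hK : K.Connected) : K.subdivision.Connected := by
  obtain ⟨a⟩ := hK.1
  refine connected_of_forall_reach (a := ⟨(a, a), K.refl a⟩) ?_
  rintro ⟨⟨b, c⟩, hbc⟩
  obtain ⟨⟨⟨b', c'⟩, h'⟩, hwalk, rfl : b' = b⟩ :=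
    K.liftsEdges_subdivision_fst.lift_reach (a := ⟨(a, a), K.refl a⟩) (mem_univ a)
      (hK.2.reach (mem_univ a) (mem_univ b))
  exact (hwalk.tail (c := ⟨(b', b'), K.refl b'⟩)
    ⟨Or.inr (Or.inl ⟨rfl, Or.inr rfl⟩), mem_univ _⟩).tail
    ⟨Or.inr (Or.inl ⟨rfl, Or.inl rfl⟩), mem_univ _⟩

theorem isConfluentEpi_subdivision_fst (hK : K.Connected) :
    K.subdivision.IsConfluentEpi K fun p => p.1.1 := by
  have := hK.subdivision.1
  refine K.liftsEdges_subdivision_fst.isConfluentEpi hK ?_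
  rintro ⟨⟨a, b⟩, hab⟩ ⟨⟨c, d⟩, hcd⟩ (h | ⟨rfl : a = c, -⟩ | ⟨-, rfl : b = c⟩)
  · cases h
    exact K.refl a
  · exact K.refl a
  · exact hab

end Subdivision

end TopGraph

open TopGraph

namespace IsConfluentFraisseLimit

section FiniteQuotients

variable {V : Type*} [TopologicalSpace V] {G : TopGraph V}

theorem exists_fibres_subset (hG : IsConfluentFraisseLimit G) {𝒰 : Set (Set V)}
    (hopen : ∀ U ∈ 𝒰, IsOpen U) (hcov : ⋃₀ 𝒰 = univ) :
    ∃ (A : Type) (_ : Finite A) (_ : TopologicalSpace A) (_ : DiscreteTopology A) (K : TopGraph A)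
      (f : V → A), K.Connected ∧ G.IsConfluentEpi K f ∧ ∀ x, ∃ U ∈ 𝒰, f ⁻¹' {f x} ⊆ U := by
  have := hG.compactSpace
  have := hG.t2Space
  have := hG.secondCountableTopology
  let m : MetricSpace V := TopologicalSpace.metrizableSpaceMetric V
  obtain ⟨δ, hδ, hball⟩ := lebesgue_number_lemma_of_metric_sUnion isCompact_univ hopen hcov.ge
  obtain ⟨A, _, _, _, K, f, hK, hf, hfδ⟩ := hG.approximation m rfl δ hδ
  refine ⟨A, ‹_›, ‹_›, ‹_›, K, f, hK, hf, fun x => ?_⟩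
  obtain ⟨U, hU, hxU⟩ := hball x (mem_univ x)
  refine ⟨U, hU, Subset.trans (fun y hy => ?_) hxU⟩
  have hbdd : Bornology.IsBounded (f ⁻¹' {f x}) := isCompact_univ.isBounded.subset (subset_univ _)
  exact (Metric.dist_le_diam_of_mem hbdd hy rfl).trans_lt (hfδ _)

theorem exists_notMem_of_eq (hG : IsConfluentFraisseLimit G) {Z : Set (V × V)} (hZ : IsClosed Z)
    (hdiag : ∀ x, (x, x) ∉ Z) :
    ∃ (A : Type) (_ : Finite A) (_ : TopologicalSpace A) (_ : DiscreteTopology A) (K : TopGraph A)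
      (f : V → A), K.Connected ∧ G.IsConfluentEpi K f ∧ ∀ x y, f x = f y → (x, y) ∉ Z := by
  obtain ⟨A, _, _, _, K, f, hK, hf, hfib⟩ := hG.exists_fibres_subset
    (𝒰 := {U | IsOpen U ∧ Disjoint (U ×ˢ U) Z}) (fun U hU => hU.1) <| by
      refine sUnion_eq_univ_iff.2 fun x => ?_
      obtain ⟨U, W, hU, hW, hxU, hxW, hUW⟩ := isOpen_prod_iff.1 hZ.isOpen_compl x x (hdiag x)
      refine ⟨U ∩ W, ⟨hU.inter hW, ?_⟩, hxU, hxW⟩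
      exact disjoint_left.2 fun p hp => hUW ⟨hp.1.1, hp.2.2⟩
  refine ⟨A, ‹_›, ‹_›, ‹_›, K, f, hK, hf, fun x y hxy => ?_⟩
  obtain ⟨U, hU, hxU⟩ := hfib x
  exact disjoint_left.1 hU.2 ⟨hxU rfl, hxU hxy.symm⟩

theorem nonempty (hG : IsConfluentFraisseLimit G) : Nonempty V := by
  obtain ⟨A, _, _, _, K, f, ⟨⟨a⟩, -⟩, hf, -⟩ :=
    hG.exists_notMem_of_eq isClosed_empty fun x => notMem_empty (x, x)
  exact (hf.surjective a).nonempty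

theorem connected (hG : IsConfluentFraisseLimit G) : G.Connected := by
  refine ⟨hG.nonempty, connectedSet_iff.2 fun S hS hSE hSne => ?_⟩
  have hS : IsClopen S := by
    simpa [isClopenOn_iff isClosed_univ, IsClopen, ← compl_eq_univ_sdiff] using hS
  obtain ⟨A, _, _, _, K, f, hK, hf, hfS⟩ := hG.exists_notMem_of_eq
    (hS.isClosed.prod hS.compl.isClosed) fun x hx => hx.2 hx.1
  have hfS : ∀ x y, f x = f y → x ∈ S → y ∈ S :=
    fun x y hxy hx => by_contra fun hy => hfS x y hxy ⟨hx, hy⟩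
  have hcover : univ ⊆ f '' S := by
    refine hK.2.subset_of_isClopenOn (isClopen_discrete _) ?_ (by simpa using hSne)
    rintro _ ⟨-, x, hx, rfl⟩ b - hb
    obtain ⟨y, z, hyz, hy, rfl⟩ := hf.surjective_edge _ _ hb
    exact mem_image_of_mem f (hSE y ⟨mem_univ y, hfS x y hy.symm hx⟩ z (mem_univ z) hyz)
  intro x _
  obtain ⟨y, hy, hyx⟩ := hcover (mem_univ (f x))
  exact hfS y x hyx hy

end FiniteQuotients

section Realization

variable {V : Type*} [TopologicalSpace V] {G : TopGraph V}

/-- If `G.Edge a b` and `G.Edge b c` but not `G.Edge a c`, a fine enough finite quotient `f` maps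
`a, b, c` to a path of length two. A lift of `f` to the subdivision would send `b` to the half edge
at `f b` towards `f a` and to the half edge at `f b` towards `f c`. -/
theorem edge_trans (hG : IsConfluentFraisseLimit G) (a b c : V) (hab : G.Edge a b)
    (hbc : G.Edge b c) : G.Edge a c := by
  by_contra hac
  have := hG.t2Space
  obtain ⟨U, W, hU, hW, haU, hcW, hUW⟩ := isOpen_prod_iff.1 G.closed.isOpen_compl a c hac
  obtain ⟨A, _, _, _, K, f, hK, hf, hfib⟩ := hG.exists_notMem_of_eq
    ((isClosed_singleton.prod hU.isClosed_compl).union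
      (isClosed_singleton.prod hW.isClosed_compl) : IsClosed ({a} ×ˢ Uᶜ ∪ {c} ×ˢ Wᶜ)) <| by
    rintro x (⟨rfl : x = a, hx⟩ | ⟨rfl : x = c, hx⟩)
    exacts [hx haU, hx hcW]
  have hfU : ∀ x, f x = f a → x ∈ U := fun x hx =>
    by_contra fun h => hfib a x hx.symm (Or.inl ⟨rfl, h⟩)
  have hfW : ∀ x, f x = f c → x ∈ W := fun x hx =>
    by_contra fun h => hfib c x hx.symm (Or.inr ⟨rfl, h⟩)
  have hfac : ¬ K.Edge (f a) (f c) := fun h => by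
    obtain ⟨x, y, hxy, hx, hy⟩ := hf.surjective_edge _ _ h
    exact hUW (mk_mem_prod (hfU x hx) (hfW y hy)) hxy
  have hne_ab : f a ≠ f b := fun h => hfac (h ▸ hf.map_edge _ _ hbc)
  have hne_bc : f b ≠ f c := fun h => hfac (h ▸ hf.map_edge _ _ hab)
  obtain ⟨h, hh, rfl⟩ :=
    hG.extension _ _ _ _ hK hK.subdivision f _ hf (isConfluentEpi_subdivision_fst hK)
  have h_ab : (h a).1.1 = (h b).1.2 :=
    (subdivision_edge_of_fst_ne (hh.map_edge a b hab) hne_ab).1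
  have h_bc : (h b).1.2 = (h c).1.1 :=
    (subdivision_edge_of_fst_ne (hh.map_edge b c hbc) hne_bc).2
  have h_ac : (h a).1.1 = (h c).1.1 := h_ab.trans h_bc
  exact hfac (by simpa only [Function.comp_apply, h_ac] using K.refl _)

theorem isContinuum_realization (hG : IsConfluentFraisseLimit G) : IsContinuum G.Realization := by
  have := hG.compactSpace
  have := hG.t2Space
  have := hG.secondCountableTopology
  have hπ := isProperMap_toRealization hG.edge_trans
  have := t2Space_of_isProperMap hπ G.surjective_toRealization
  have := secondCountableTopology_of_isProperMap hπ G.surjective_toRealization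
  have : CompactSpace G.Realization := Quot.compactSpace
  exact ⟨inferInstance, hG.connected.connectedSpace_realization, inferInstance⟩

end Realization

end IsConfluentFraisseLimit

section CyclicCut

variable {X Y : Type*} [TopologicalSpace X] [TopologicalSpace Y] {P Q M N : Set X}

/-- `M` meets every nonempty relatively clopen subset of `P`. -/
def MeetsClopenSubsets (M P : Set X) : Prop :=
  ∀ S, IsClopenOn S P → (P ∩ S).Nonempty → (S ∩ M).Nonempty

theorem MeetsClopenSubsets.preimage (h : MeetsClopenSubsets M P) (e : Y ≃ₜ X) :
    MeetsClopenSubsets (e ⁻¹' M) (e ⁻¹' P) := by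
  rintro S hS ⟨y, hyP, hyS⟩
  obtain ⟨x, hxS, hxM⟩ := h (e.symm ⁻¹' S)
    (hS.preimage e.symm.continuous.continuousOn fun x hx => by simpa using hx)
    ⟨e y, hyP, by simpa using hyS⟩
  exact ⟨e.symm x, hxS, by simpa using hxM⟩

/-- A space is cut into two closed pieces `P` and `Q`, which meet in two disjoint closed sets `M`
and `N`, in such a way that `M` cannot be avoided by relatively clopen subsets of the pieces. One
imagines a flow that runs from `P` through `M` to `Q` and through `N` back to `P`. -/
structure IsCyclicCut (P Q M N : Set X) : Prop where
  isClosed_left : IsClosed P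
  isClosed_right : IsClosed Q
  isClosed_mid : IsClosed M
  isClosed_cut : IsClosed N
  union : P ∪ Q = univ
  inter : P ∩ Q = M ∪ N
  disjoint : Disjoint M N
  left_meets : MeetsClopenSubsets M P
  right_meets : MeetsClopenSubsets M Q

/-- Relatively clopen subsets `S` of `P` and `R` of `Q` with the same trace on `M` such that the
flow of `IsCyclicCut` does not leave them through `N`. -/
structure IsForwardPair (P Q M N S R : Set X) : Prop where
  left : IsClopenOn S P
  right : IsClopenOn R Q
  mid : ∀ x ∈ M, x ∈ S ↔ x ∈ R
  cut : ∀ x ∈ N, x ∈ R → x ∈ S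

/-- A point on the cut `N` of some cyclic cut at which the flow cannot enter any forward pair. This
is a topological property, hence preserved by homeomorphisms. -/
def IsRecurrentPoint (x : X) : Prop :=
  ∃ P Q M N : Set X, IsCyclicCut P Q M N ∧ x ∈ N ∧
    ∀ S R, IsForwardPair P Q M N S R → x ∈ S → x ∈ R

theorem IsCyclicCut.preimage (h : IsCyclicCut P Q M N) (e : Y ≃ₜ X) :
    IsCyclicCut (e ⁻¹' P) (e ⁻¹' Q) (e ⁻¹' M) (e ⁻¹' N) where
  isClosed_left := h.isClosed_left.preimage e.continuous
  isClosed_right := h.isClosed_right.preimage e.continuous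
  isClosed_mid := h.isClosed_mid.preimage e.continuous
  isClosed_cut := h.isClosed_cut.preimage e.continuous
  union := by rw [← preimage_union, h.union, preimage_univ]
  inter := by rw [← preimage_inter, h.inter, preimage_union]
  disjoint := h.disjoint.preimage e
  left_meets := h.left_meets.preimage e
  right_meets := h.right_meets.preimage e

theorem IsForwardPair.of_preimage {S R : Set Y} {e : Y ≃ₜ X}
    (h : IsForwardPair (e ⁻¹' P) (e ⁻¹' Q) (e ⁻¹' M) (e ⁻¹' N) S R) :
    IsForwardPair P Q M N (e.symm ⁻¹' S) (e.symm ⁻¹' R) where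
  left := h.left.preimage e.symm.continuous.continuousOn fun x hx => by simpa using hx
  right := h.right.preimage e.symm.continuous.continuousOn fun x hx => by simpa using hx
  mid x hx := h.mid (e.symm x) (by simpa using hx)
  cut x hx := h.cut (e.symm x) (by simpa using hx)

theorem IsRecurrentPoint.of_homeomorph (e : Y ≃ₜ X) {y : Y} (hy : IsRecurrentPoint (e y)) :
    IsRecurrentPoint y := by
  obtain ⟨P, Q, M, N, hcut, hyN, hrec⟩ := hy
  refine ⟨_, _, _, _, hcut.preimage e, hyN, fun S R hSR hS => ?_⟩
  simpa using hrec _ _ hSR.of_preimage (by simpa using hS)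

namespace IsCyclicCut

theorem cut_subset_left (h : IsCyclicCut P Q M N) : N ⊆ P :=
  fun _ hx => (h.inter.ge (Or.inr hx)).1

theorem cut_subset_right (h : IsCyclicCut P Q M N) : N ⊆ Q :=
  fun _ hx => (h.inter.ge (Or.inr hx)).2

theorem mid_subset_left (h : IsCyclicCut P Q M N) : M ⊆ P :=
  fun _ hx => (h.inter.ge (Or.inl hx)).1

theorem mid_subset_right (h : IsCyclicCut P Q M N) : M ⊆ Q :=
  fun _ hx => (h.inter.ge (Or.inl hx)).2

/-- Follow the flow from a point of `Q` that lies in a maximal set of the `R i` through `N` to `P`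
and through `M` back to `Q`, staying within the traces of the given sets. No new `R i` can be
entered. -/
theorem exists_mem_cut_of_finite (h : IsCyclicCut P Q M N) (hQ : Q.Nonempty)
    (hQN : MeetsClopenSubsets N Q) {ι : Type*} {T : Set ι} (hT : T.Finite) {S R : ι → Set X}
    (hSR : ∀ i ∈ T, IsForwardPair P Q M N (S i) (R i)) :
    ∃ x ∈ N, ∀ i ∈ T, x ∈ S i → x ∈ R i := by
  let index (y : X) : Set ι := {i ∈ T | y ∈ R i}
  obtain ⟨z, hzQ, hzmax⟩ := Set.Finite.exists_maximalFor' index Q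
    (hT.finite_subsets.subset (image_subset_iff.2 fun y _ => sep_subset T _)) hQ
  obtain ⟨x, hxz, hxN⟩ := hQN _ (IsClopenOn.forall_mem_iff hT (fun i hi => (hSR i hi).right) z)
    ⟨z, hzQ, fun _ _ => Iff.rfl⟩
  obtain ⟨m, hmx, hmM⟩ :=
    h.left_meets _ (IsClopenOn.forall_mem_iff hT (fun i hi => (hSR i hi).left) x)
      ⟨x, h.cut_subset_left hxN, fun _ _ => Iff.rfl⟩
  have hmR : ∀ i ∈ T, (m ∈ R i ↔ x ∈ S i) := fun i hi =>
    ((hSR i hi).mid m hmM).symm.trans (hmx i hi)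
  have hzm : index z ⊆ index m := fun i ⟨hi, hzi⟩ =>
    ⟨hi, (hmR i hi).2 ((hSR i hi).cut x hxN ((hxz i hi).2 hzi))⟩
  have hmz : index m ⊆ index z := hzmax (h.mid_subset_right hmM) hzm
  exact ⟨x, hxN, fun i hi hx => (hxz i hi).2 (hmz ⟨hi, (hmR i hi).2 hx⟩).2⟩

theorem exists_isRecurrentPoint [CompactSpace X] (h : IsCyclicCut P Q M N) (hQ : Q.Nonempty)
    (hQN : MeetsClopenSubsets N Q) : ∃ x : X, IsRecurrentPoint x := by
  let ι := {SR : Set X × Set X // IsForwardPair P Q M N SR.1 SR.2}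
  have hclosed : ∀ i : ι, IsClosed (N \ i.1.1 ∪ N ∩ i.1.2) := fun i =>
    ((isClopenOn_iff h.isClosed_cut).1 (i.2.left.mono h.cut_subset_left)).2.union
      ((isClopenOn_iff h.isClosed_cut).1 (i.2.right.mono h.cut_subset_right)).1
  obtain ⟨x, hxN, hx⟩ := h.isClosed_cut.isCompact.inter_iInter_nonempty _ hclosed fun T => by
    obtain ⟨x, hxN, hx⟩ := h.exists_mem_cut_of_finite hQ hQN T.finite_toSet
      (S := fun i : ι => i.1.1) (R := fun i => i.1.2) fun i _ => i.2
    exact ⟨x, hxN, mem_iInter₂.2 fun i hi =>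
      (em (x ∈ i.1.1)).symm.imp (fun hS => ⟨hxN, hS⟩) fun hS => ⟨hxN, hx i hi hS⟩⟩
  refine ⟨x, P, Q, M, N, h, hxN, fun S R hSR hS => ?_⟩
  exact ((mem_iInter.1 hx ⟨(S, R), hSR⟩).resolve_left fun hx => hx.2 hS).2

end IsCyclicCut

end CyclicCut

namespace TopGraph

section Piece

variable {V A : Type*} [TopologicalSpace V] {G : TopGraph V} {k : V → A}

/-- The part of the realization that is represented by the vertices with label in `s`. -/
def piece (G : TopGraph V) (k : V → A) (s : Set A) : Set G.Realization :=
  G.toRealization '' (k ⁻¹' s)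

theorem piece_insert (a : A) (s : Set A) :
    G.piece k (insert a s) = G.piece k {a} ∪ G.piece k s := by
  rw [insert_eq, piece, preimage_union, image_union, piece, piece]

variable [TopologicalSpace A] {K : TopGraph A}

theorem disjoint_piece (hG : ∀ a b c, G.Edge a b → G.Edge b c → G.Edge a c)
    (hk : ∀ a b, G.Edge a b → K.Edge (k a) (k b)) {a b : A} (hab : ¬ K.Edge a b) :
    Disjoint (G.piece k {a}) (G.piece k {b}) := by
  rw [disjoint_left]
  rintro _ ⟨x, rfl : k x = a, rfl⟩ ⟨y, rfl : k y = b, hyx⟩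
  exact hab (K.symm _ _ (hk y x ((toRealization_eq_iff hG).1 hyx)))

variable [DiscreteTopology A]

theorem isClosed_piece [CompactSpace V] (hG : ∀ a b c, G.Edge a b → G.Edge b c → G.Edge a c)
    (hk : Continuous k) (s : Set A) : IsClosed (G.piece k s) :=
  (isProperMap_toRealization hG).isClosedMap _ ((isClosed_discrete s).preimage hk)

/-- A component over `{a, b}` must reach the vertices over `b`, and from there a component over
`{b, c}` must leave them towards `c`. -/
theorem IsConfluentEpi.meetsClopenSubsets_piece (hk : G.IsConfluentEpi K k) {a b c : A}
    (hab : K.Edge a b) (hbc : K.Edge b c) (hcb : c ≠ b) :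
    MeetsClopenSubsets (G.piece k {b} ∩ G.piece k {c}) (G.piece k {a, b}) := by
  rintro S hS ⟨_, ⟨x, hx, rfl⟩, hxS⟩
  by_contra hcon
  have hS : IsClopenOn (G.toRealization ⁻¹' S) (k ⁻¹' {a, b}) :=
    hS.preimage G.continuous_toRealization.continuousOn (mapsTo_image _ _)
  obtain ⟨y, hy, hyb⟩ := (hk.confluent _ (connectedSet_pair hab) x hx).ge (Or.inr rfl)
  have hyS : y ∈ G.toRealization ⁻¹' S := by
    refine (G.connectedSet_component _ x).subset_of_isClopenOn (hS.mono (G.component_subset _ x))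
      (fun z hz w _ hzw => ?_) ⟨x, G.mem_component_self hx, hxS⟩ hy
    exact (toRealization_eq_of_edge hzw ▸ hz.2 : G.toRealization w ∈ S)
  have hU : IsClopen (G.toRealization ⁻¹' S ∩ k ⁻¹' {b}) :=
    (hS.mono (preimage_mono (subset_insert a {b}))).isClopen_inter
      ((isClopen_discrete _).preimage hk.continuous)
  obtain ⟨z, hz, hzc⟩ :=
    (hk.confluent _ (connectedSet_pair hbc) y (Or.inl hyb)).ge (Or.inr rfl)
  have hzU : z ∈ G.toRealization ⁻¹' S ∩ k ⁻¹' {b} := by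
    refine (G.connectedSet_component _ y).subset_of_isClopenOn
      (hU.preimage continuous_subtype_val) ?_ ⟨y, G.mem_component_self (Or.inl hyb), hyS, hyb⟩ hz
    rintro v ⟨-, hvS, hvb⟩ w hw hvw
    have hvw := toRealization_eq_of_edge hvw
    have hwS : G.toRealization w ∈ S := hvw ▸ hvS
    refine ⟨hwS, (G.component_subset _ y hw).resolve_right fun hwc => hcon ?_⟩
    exact ⟨_, hwS, ⟨v, hvb, hvw⟩, ⟨w, hwc, rfl⟩⟩
  exact hcb (hzc.symm.trans hzU.2)

end Piece

section FourCycle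

/-- The cycle of length four. -/
def fourCycle : TopGraph (Fin 4) where
  Edge i j := j = i ∨ j = i + 1 ∨ i = j + 1
  refl _ := Or.inl rfl
  symm i j := by
    rintro (h | h | h)
    exacts [Or.inl h.symm, Or.inr (Or.inr h), Or.inr (Or.inl h)]
  closed := isClosed_discrete _

theorem fourCycle_edge_add_one (i : Fin 4) : fourCycle.Edge i (i + 1) :=
  Or.inr (Or.inl rfl)

theorem fourCycle_not_edge_add_two (i : Fin 4) : ¬ fourCycle.Edge i (i + 2) := by
  simp only [fourCycle]
  decide +revert

theorem connected_fourCycle : fourCycle.Connected := by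
  refine connected_of_forall_reach (a := 0) fun i => ?_
  induction i using Fin.induction with
  | zero => exact ReflTransGen.refl
  | succ i ih =>
    exact ih.tail ⟨by simpa using fourCycle_edge_add_one i.castSucc, mem_univ _⟩

variable {V : Type*} [TopologicalSpace V] {G : TopGraph V} {k : V → Fin 4}

theorem isCyclicCut_piece [CompactSpace V] (hG : ∀ a b c, G.Edge a b → G.Edge b c → G.Edge a c)
    (hk : G.IsConfluentEpi fourCycle k) :
    IsCyclicCut (G.piece k {0, 1}) (G.piece k {2, 3}) (G.piece k {1} ∩ G.piece k {2})
      (G.piece k {3} ∩ G.piece k {0}) := by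
  have hclosed := isClosed_piece hG hk.continuous
  have hdisj₀₂ : Disjoint (G.piece k {0}) (G.piece k {2}) :=
    disjoint_piece hG hk.map_edge (fourCycle_not_edge_add_two 0)
  have hdisj₁₃ : Disjoint (G.piece k {1}) (G.piece k {3}) :=
    disjoint_piece hG hk.map_edge (fourCycle_not_edge_add_two 1)
  refine ⟨hclosed _, hclosed _, (hclosed _).inter (hclosed _), (hclosed _).inter (hclosed _),
    ?_, ?_, hdisj₁₃.mono inter_subset_left inter_subset_left, ?_, ?_⟩
  · have hlabels : ({0, 1} ∪ {2, 3} : Set (Fin 4)) = univ := by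
      ext i
      fin_cases i <;> simp
    rw [piece, piece, ← image_union, ← preimage_union, hlabels, preimage_univ, image_univ,
      G.surjective_toRealization.range_eq]
  · rw [piece_insert, piece_insert, union_inter_distrib_right, inter_union_distrib_left,
      inter_union_distrib_left, hdisj₀₂.inter_eq, hdisj₁₃.inter_eq, empty_union, union_empty,
      union_comm, inter_comm (G.piece k {0})]
  · exact hk.meetsClopenSubsets_piece (fourCycle_edge_add_one 0) (fourCycle_edge_add_one 1)
      (by decide)
  · rw [inter_comm, pair_comm]
    exact hk.meetsClopenSubsets_piece (fourCycle.symm _ _ (fourCycle_edge_add_one 2))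
      (fourCycle.symm _ _ (fourCycle_edge_add_one 1)) (by decide)

end FourCycle

end TopGraph

theorem IsConfluentFraisseLimit.exists_isRecurrentPoint {V : Type*} [TopologicalSpace V]
    {G : TopGraph V} (hG : IsConfluentFraisseLimit G) :
    ∃ x : G.Realization, IsRecurrentPoint x := by
  have := hG.compactSpace
  have : CompactSpace G.Realization := Quot.compactSpace
  obtain ⟨k, hk⟩ := hG.projective_universal (Fin 4) fourCycle connected_fourCycle
  refine (isCyclicCut_piece hG.edge_trans hk).exists_isRecurrentPoint ?_
    (hk.meetsClopenSubsets_piece (fourCycle_edge_add_one 2) (fourCycle_edge_add_one 3) (by decide))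
  obtain ⟨x, hx⟩ := hk.surjective 2
  exact ⟨_, x, Or.inl hx, rfl⟩

namespace TopGraph

section Transport

variable {V W : Type*} [TopologicalSpace V] [TopologicalSpace W]

theorem isConfluentEpi_of_homeomorph {G : TopGraph V} {H : TopGraph W} (e : V ≃ₜ W)
    (hE : ∀ a b, G.Edge a b ↔ H.Edge (e a) (e b)) : G.IsConfluentEpi H e where
  continuous := e.continuous
  map_edge a b := (hE a b).1
  surjective := e.surjective
  surjective_edge c d hcd :=
    ⟨e.symm c, e.symm d, (hE _ _).2 (by simpa using hcd), by simp, by simp⟩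
  confluent Q hQ a ha := by
    have hconn : G.ConnectedSet (e.symm '' Q) :=
      hQ.image e.symm.continuous fun c d hcd => (hE _ _).2 (by simpa using hcd)
    rw [e.image_symm] at hconn
    refine Subset.antisymm (image_subset_iff.2 (G.component_subset _ a)) ?_
    rw [← e.image_preimage Q]
    exact image_mono (by simpa using hconn.subset_component Subset.rfl ha)

theorem isConfluentEpi_id (G : TopGraph V) : G.IsConfluentEpi G id :=
  isConfluentEpi_of_homeomorph (Homeomorph.refl V) fun _ _ => Iff.rfl

/-- The copy of a graph on a homeomorphic space of vertices. -/
def transport (G : TopGraph V) (e : V ≃ₜ W) : TopGraph W where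
  Edge a b := G.Edge (e.symm a) (e.symm b)
  refl _ := G.refl _
  symm _ _ := G.symm _ _
  closed := G.closed.preimage (e.symm.continuous.prodMap e.symm.continuous)

theorem isConfluentEpi_transport (G : TopGraph V) (e : V ≃ₜ W) :
    G.IsConfluentEpi (G.transport e) e :=
  isConfluentEpi_of_homeomorph e fun a b => by simp [transport]

theorem isConfluentEpi_transport_symm (G : TopGraph V) (e : V ≃ₜ W) :
    (G.transport e).IsConfluentEpi G e.symm :=
  isConfluentEpi_of_homeomorph e.symm fun _ _ => Iff.rfl

theorem Connected.transport {G : TopGraph V} (hG : G.Connected) (e : V ≃ₜ W) :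
    (G.transport e).Connected :=
  hG.of_isEpi (G.isConfluentEpi_transport e).toIsEpi

instance [Finite V] : Finite (TopGraph V) :=
  Finite.of_injective (fun G : TopGraph V => G.Edge) fun G H h => by
    cases G
    cases H
    congr

end Transport

end TopGraph

section GenericVertex

theorem exists_homeomorph_fin (A : Type*) [Finite A] [TopologicalSpace A] [DiscreteTopology A] :
    ∃ n, Nonempty (A ≃ₜ Fin n) := by
  obtain ⟨n, ⟨e⟩⟩ := Finite.exists_equiv_fin A
  exact ⟨n, ⟨e.toHomeomorphOfDiscrete⟩⟩

theorem countable_continuousMap_of_discreteTopology (X A : Type*) [TopologicalSpace X]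
    [CompactSpace X] [T2Space X] [TotallyDisconnectedSpace X] [SecondCountableTopology X]
    [TopologicalSpace A] [DiscreteTopology A] [Finite A] : Countable C(X, A) := by
  have : Countable (TopologicalSpace.Clopens X) :=
    TopologicalSpace.Clopens.countable_iff_secondCountable.2 inferInstance
  let fibre (f : C(X, A)) (a : A) : TopologicalSpace.Clopens X :=
    ⟨f ⁻¹' {a}, (isClopen_discrete _).preimage f.continuous⟩
  refine Function.Injective.countable (f := fibre) fun f g hfg => ContinuousMap.ext fun x => ?_
  have hx : x ∈ fibre g (f x) := congrFun hfg (f x) ▸ rfl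
  exact Eq.symm hx

variable {V : Type*} [TopologicalSpace V] {G : TopGraph V} {A B : Type} [TopologicalSpace A]
  [TopologicalSpace B]

/-- The vertices that can be sent to `b` by a solution of the extension problem given by `f` and
`g`, together with the vertices for which the problem with this constraint makes no sense. -/
def extensionSet (G : TopGraph V) (L : TopGraph B) (f : V → A) (g : B → A) (b : B) : Set V :=
  {y | g b = f y → ∃ h : V → B, G.IsConfluentEpi L h ∧ f = g ∘ h ∧ h y = b}

/-- A vertex that can be sent to any prescribed admissible vertex by some solution of an extension
problem. -/
def IsGenericVertex (G : TopGraph V) (y : V) : Prop :=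
  ∀ (A B : Type) [Finite A] [TopologicalSpace A] [DiscreteTopology A]
    [Finite B] [TopologicalSpace B] [DiscreteTopology B] (K : TopGraph A) (L : TopGraph B),
    L.Connected → ∀ (f : V → A) (g : B → A) (b : B),
    G.IsConfluentEpi K f → L.IsConfluentEpi K g → y ∈ extensionSet G L f g b

variable [DiscreteTopology A] [DiscreteTopology B] {K : TopGraph A} {L : TopGraph B} {f : V → A}
  {g : B → A}

theorem isOpen_extensionSet (hf : Continuous f) (b : B) : IsOpen (extensionSet G L f g b) := by
  rw [isOpen_iff_forall_mem_open]
  intro y hy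
  by_cases hby : g b = f y
  · obtain ⟨h, hh, hfgh, hyb⟩ := hy hby
    exact ⟨h ⁻¹' {b}, fun z hz _ => ⟨h, hh, hfgh, hz⟩,
      (isOpen_discrete _).preimage hh.continuous, hyb⟩
  · exact ⟨f ⁻¹' {f y}, fun z (hz : f z = f y) hbz => absurd (hbz.trans hz) hby,
      (isOpen_discrete _).preimage hf, rfl⟩

namespace IsConfluentFraisseLimit

theorem exists_factorization_of_isOpen (hG : IsConfluentFraisseLimit G)
    (hf : G.IsConfluentEpi K f) {y : V} {U : Set V} (hU : IsOpen U) (hy : y ∈ U) :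
    ∃ (C : Type) (_ : Finite C) (_ : TopologicalSpace C) (_ : DiscreteTopology C) (M : TopGraph C)
      (r : V → C) (s : C → A), M.Connected ∧ G.IsConfluentEpi M r ∧ M.IsConfluentEpi K s ∧
      s ∘ r = f ∧ ∀ z, r z = r y → z ∈ U := by
  have := hG.t2Space
  obtain ⟨C, _, _, _, M, r, hM, hr, hrZ⟩ := hG.exists_notMem_of_eq
    (((isClosed_discrete {p : A × A | p.1 ≠ p.2}).preimage
      (hf.continuous.prodMap hf.continuous)).union (isClosed_singleton.prod hU.isClosed_compl) :
        IsClosed (Prod.map f f ⁻¹' {p | p.1 ≠ p.2} ∪ {y} ×ˢ Uᶜ)) <| by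
    rintro x (hx | ⟨rfl : x = y, hx⟩)
    exacts [hx rfl, hx hy]
  have hrf : ∀ x z, r x = r z → f x = f z := fun x z hxz =>
    by_contra fun hne => hrZ x z hxz (Or.inl hne)
  have hrU : ∀ z, r z = r y → z ∈ U := fun z hz =>
    by_contra fun hzU => hrZ y z hz.symm (Or.inr ⟨rfl, hzU⟩)
  have hsr : (f ∘ Function.surjInv hr.surjective) ∘ r = f :=
    funext fun x => hrf _ _ (Function.surjInv_eq hr.surjective (r x))
  exact ⟨C, ‹_›, ‹_›, ‹_›, M, r, _, hM, hr,
    .of_comp continuous_of_discreteTopology (hsr.symm ▸ hf) hr.toIsEpi, hsr, hrU⟩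

theorem dense_extensionSet [Finite B] (hG : IsConfluentFraisseLimit G) (hL : L.Connected)
    (hf : G.IsConfluentEpi K f) (hg : L.IsConfluentEpi K g) (b : B) :
    Dense (extensionSet G L f g b) := by
  rw [dense_iff_inter_open]
  rintro U hU ⟨y, hy⟩
  by_cases hby : g b = f y
  · obtain ⟨C, _, _, _, M, r, s, hM, hr, hs, rfl, hrU⟩ :=
      hG.exists_factorization_of_isOpen hf hU hy
    obtain ⟨D, _, _, _, N, p, q, d, hN, hp, hq, hpq, hpd, hqd⟩ :=
      exists_amalgam hM hL hs hg (b := r y) (c := b) hby.symm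
    obtain ⟨h, hh, rfl⟩ := hG.extension C D M N hM hN r p hr hp
    obtain ⟨z, rfl⟩ := hh.surjective d
    refine ⟨z, hrU z hpd, fun _ => ⟨q ∘ h, hq.comp hh, ?_, hqd⟩⟩
    rw [← Function.comp_assoc, hpq, Function.comp_assoc]
  · exact ⟨y, hy, fun h => absurd h hby⟩

/-- By the Baire category theorem, since up to isomorphism there are only countably many extension
problems. -/
theorem exists_isGenericVertex (hG : IsConfluentFraisseLimit G) : ∃ y, IsGenericVertex G y := by
  have := hG.compactSpace
  have := hG.t2Space
  have := hG.totallyDisconnectedSpace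
  have := hG.secondCountableTopology
  have := hG.nonempty
  have (m : ℕ) : Countable C(V, Fin m) := countable_continuousMap_of_discreteTopology V (Fin m)
  have hresidual : ∀ᶠ y in residual V, ∀ (m n : ℕ) (K : TopGraph (Fin m)) (L : TopGraph (Fin n))
      (f : C(V, Fin m)) (g : Fin n → Fin m) (b : Fin n), L.Connected → G.IsConfluentEpi K f →
      L.IsConfluentEpi K g → y ∈ extensionSet G L f g b := by
    simp only [eventually_countable_forall]
    exact fun m n K L f g b hL hf hg => residual_of_dense_open
      (isOpen_extensionSet hf.continuous b) (hG.dense_extensionSet hL hf hg b)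
  obtain ⟨y, hy⟩ := (dense_of_mem_residual hresidual).nonempty
  refine ⟨y, fun A B _ _ _ _ _ _ K L hL f g b hf hg hby => ?_⟩
  obtain ⟨m, ⟨e⟩⟩ := exists_homeomorph_fin A
  obtain ⟨n, ⟨e'⟩⟩ := exists_homeomorph_fin B
  have hf' := (K.isConfluentEpi_transport e).comp hf
  obtain ⟨h, hh, hfh, hhy⟩ := hy m n (K.transport e) (L.transport e') ⟨e ∘ f, hf'.continuous⟩
    (e ∘ g ∘ e'.symm) (e' b) (hL.transport e') hf'
    ((K.isConfluentEpi_transport e).comp (hg.comp (L.isConfluentEpi_transport_symm e')))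
    (by simp [hby])
  refine ⟨e'.symm ∘ h, (L.isConfluentEpi_transport_symm e').comp hh, ?_, by simp [hhy]⟩
  exact funext fun x => e.injective (congrFun hfh x)

end IsConfluentFraisseLimit

end GenericVertex

namespace TopGraph

section TwoSheet

variable {C : Type*} [TopologicalSpace C] {K : TopGraph C} {P Q N : Set C}

/-- A cyclic cut of a finite graph into `P` and `Q`: the part `N` of `P ∩ Q` is separated from the
rest of `P ∩ Q`, which can be reached from everywhere within `P` and within `Q`. -/
structure IsFiniteCut (K : TopGraph C) (P Q N : Set C) : Prop where
  cut_subset_left : N ⊆ P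
  cut_subset_right : N ⊆ Q
  edge_cases : ∀ c d, K.Edge c d → c ∈ P ∧ d ∈ P ∨ c ∈ Q ∧ d ∈ Q
  mem_cut_of_edge : ∀ c d, K.Edge c d → c ∈ N → d ∈ P ∩ Q → d ∈ N
  left_reach : ∀ c ∈ P, ∃ m ∉ N, K.Reach P c m
  right_reach : ∀ c ∈ Q, ∃ m ∉ N, K.Reach Q c m

/-- The vertices of the two-sheeted cover `twoSheet` of a graph: `left` and `right` are the sheets
on which a vertex is seen from `P` and from `Q`. They may differ over the cut `N`, but only by a
passage from sheet `false` in `Q` to sheet `true` in `P`. -/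
@[ext]
structure SheetVertex (N : Set C) where
  base : C
  left : Bool
  right : Bool
  right_le_left : right ≤ left
  left_eq_right : base ∉ N → left = right

namespace SheetVertex

instance : TopologicalSpace (SheetVertex N) := ⊥

instance : DiscreteTopology (SheetVertex N) := ⟨rfl⟩

instance [Finite C] : Finite (SheetVertex N) :=
  Finite.of_injective (fun x : SheetVertex N => (x.base, x.left, x.right)) fun x y hxy => by
    simpa [SheetVertex.ext_iff] using hxy

/-- The vertex over `c` that lies on the sheet `s` for both `P` and `Q`. -/
def onSheet (s : Bool) (c : C) : SheetVertex N :=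
  ⟨c, s, s, le_rfl, fun _ => rfl⟩

/-- The vertex over a point of the cut which passes from one sheet to the other. -/
def passage {c : C} (hc : c ∈ N) : SheetVertex N :=
  ⟨c, true, false, Bool.false_le true, fun h => absurd hc h⟩

end SheetVertex

open SheetVertex

/-- Two copies of a graph that is covered by `P` and `Q`, with additional vertices over a part `N`
of `P ∩ Q` which lead from the first copy of `Q` to the second copy of `P`. -/
def twoSheet (K : TopGraph C) (P Q N : Set C) : TopGraph (SheetVertex N) where
  Edge x y := K.Edge x.base y.base ∧ (x.base ∈ P → y.base ∈ P → x.left = y.left) ∧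
    (x.base ∈ Q → y.base ∈ Q → x.right = y.right)
  refl _ := ⟨K.refl _, fun _ _ => rfl, fun _ _ => rfl⟩
  symm _ _ h := ⟨K.symm _ _ h.1, fun hy hx => (h.2.1 hx hy).symm, fun hy hx => (h.2.2 hx hy).symm⟩
  closed := isClosed_discrete _

namespace IsFiniteCut

theorem liftsEdges_twoSheet (hN : IsFiniteCut K P Q N) :
    (K.twoSheet P Q N).LiftsEdges K SheetVertex.base := by
  intro x d hxd
  suffices h : ∃ y, (K.twoSheet P Q N).Edge x y ∧ y.base = d from
    h.imp fun y hy => ⟨ReflTransGen.single ⟨hy.1, Or.inr hy.2⟩, hy.2⟩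
  by_cases hd : d ∈ N
  · exact ⟨⟨d, x.left, x.right, x.right_le_left, fun h => absurd hd h⟩,
      ⟨hxd, fun _ _ => rfl, fun _ _ => rfl⟩, rfl⟩
  · by_cases hP : x.base ∈ P ∧ d ∈ P
    · refine ⟨onSheet x.left d, ⟨hxd, fun _ _ => rfl, fun _ hdQ => ?_⟩, rfl⟩
      exact (x.left_eq_right fun hx => hd (hN.mem_cut_of_edge _ _ hxd hx ⟨hP.2, hdQ⟩)).symm
    · exact ⟨onSheet x.right d, ⟨hxd, fun hx hd => absurd ⟨hx, hd⟩ hP, fun _ _ => rfl⟩, rfl⟩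

theorem reach_onSheet [DiscreteTopology C] (hN : IsFiniteCut K P Q N) (hK : K.Connected)
    {T : Set C} {sheet : SheetVertex N → Bool}
    (hsheet : ∀ x y, (K.twoSheet P Q N).Edge x y → x.base ∈ T → y.base ∈ T → sheet x = sheet y)
    (hdiag : ∀ y, y.base ∉ N → y = onSheet (sheet y) y.base) {x : SheetVertex N}
    (hx : x.base ∈ T) (hm : ∃ m ∉ N, K.Reach T x.base m) (c : C) :
    (K.twoSheet P Q N).Reach univ x (onSheet (sheet x) c) := by
  obtain ⟨m, hmN, hm⟩ := hm
  obtain ⟨y, hxy, rfl⟩ := hN.liftsEdges_twoSheet.lift_reach hx hm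
  have hy : sheet y = sheet x :=
    (hxy.mem_of_edge_closed (U := {y | y.base ∈ T ∧ sheet y = sheet x})
      (fun v hv w hw hvw => ⟨hw, (hsheet v w hvw hv.1 hw).symm.trans hv.2⟩) ⟨hx, rfl⟩).2
  have hyc : (K.twoSheet P Q N).Reach univ (onSheet (sheet x) y.base) (onSheet (sheet x) c) :=
    (hK.2.reach (mem_univ y.base) (mem_univ c)).map (H := K.twoSheet P Q N)
      (fun a b hab => ⟨hab, fun _ _ => rfl, fun _ _ => rfl⟩) (mapsTo_univ _ _)
  have hyx : y = onSheet (sheet x) y.base := (hdiag y hmN).trans (by rw [hy])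
  exact (hxy.mono (subset_univ _)).trans (hyx ▸ hyc)

theorem reach_onSheet_left [DiscreteTopology C] (hN : IsFiniteCut K P Q N) (hK : K.Connected)
    {x : SheetVertex N} (hx : x.base ∈ P) (c : C) :
    (K.twoSheet P Q N).Reach univ x (onSheet x.left c) :=
  hN.reach_onSheet hK (fun _ _ h => h.2.1)
    (fun y hy => SheetVertex.ext rfl rfl (y.left_eq_right hy).symm) hx (hN.left_reach _ hx) c

theorem reach_onSheet_right [DiscreteTopology C] (hN : IsFiniteCut K P Q N) (hK : K.Connected)
    {x : SheetVertex N} (hx : x.base ∈ Q) (c : C) :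
    (K.twoSheet P Q N).Reach univ x (onSheet x.right c) :=
  hN.reach_onSheet hK (fun _ _ h => h.2.2)
    (fun y hy => SheetVertex.ext rfl (y.left_eq_right hy) rfl) hx (hN.right_reach _ hx) c

theorem connected_twoSheet [DiscreteTopology C] (hN : IsFiniteCut K P Q N) (hK : K.Connected)
    (hne : N.Nonempty) : (K.twoSheet P Q N).Connected := by
  obtain ⟨c, hc⟩ := hne
  have hpassage : ∀ s, (K.twoSheet P Q N).Reach univ (passage hc) (onSheet s c) := by
    rintro (_ | _)
    exacts [hN.reach_onSheet_right hK (x := passage hc) (hN.cut_subset_right hc) c,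
      hN.reach_onSheet_left hK (x := passage hc) (hN.cut_subset_left hc) c]
  refine connected_of_forall_reach (a := passage hc) fun x => ?_
  rcases hN.edge_cases _ _ (K.refl x.base) with h | h
  · exact (hpassage _).trans ((hN.reach_onSheet_left hK h.1 c).symm (mem_univ x))
  · exact (hpassage _).trans ((hN.reach_onSheet_right hK h.1 c).symm (mem_univ x))

theorem isConfluentEpi_base [DiscreteTopology C] (hN : IsFiniteCut K P Q N) (hK : K.Connected)
    (hne : N.Nonempty) : (K.twoSheet P Q N).IsConfluentEpi K SheetVertex.base :=
  have := (hN.connected_twoSheet hK hne).1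
  hN.liftsEdges_twoSheet.isConfluentEpi hK fun _ _ h => h.1

end IsFiniteCut

end TwoSheet

section FiniteModel

variable {V : Type*} [TopologicalSpace V] [CompactSpace V] {G : TopGraph V}
  {P M : Set G.Realization}

theorem exists_isClopenOn_realization (hG : ∀ a b c, G.Edge a b → G.Edge b c → G.Edge a c)
    (hP : IsClosed P) {U : Set V} (hU : IsClopen U)
    (hE : ∀ x y, G.Edge x y → G.toRealization x ∈ P → x ∈ U → y ∈ U) :
    ∃ S, IsClopenOn S P ∧ ∀ x, G.toRealization x ∈ P → (G.toRealization x ∈ S ↔ x ∈ U) := by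
  have hclosed : ∀ {T : Set V}, IsClosed T →
      IsClosed (G.toRealization '' (G.toRealization ⁻¹' P ∩ T)) := fun hT =>
    (isProperMap_toRealization hG).isClosedMap _ ((hP.preimage G.continuous_toRealization).inter hT)
  have hmem : ∀ x, G.toRealization x ∈ P →
      (G.toRealization x ∈ G.toRealization '' (G.toRealization ⁻¹' P ∩ U) ↔ x ∈ U) := by
    refine fun x hx => ⟨?_, fun hxU => ⟨x, ⟨hx, hxU⟩, rfl⟩⟩
    rintro ⟨y, ⟨hyP, hyU⟩, hyx⟩
    exact hE y x ((toRealization_eq_iff hG).1 hyx) hyP hyU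
  refine ⟨_, (isClopenOn_iff hP).2 ⟨?_, ?_⟩, hmem⟩
  · exact hP.inter (hclosed hU.isClosed)
  · convert hclosed hU.compl.isClosed using 1
    ext q
    constructor
    · rintro ⟨hqP, hqU⟩
      obtain ⟨x, rfl⟩ := G.surjective_toRealization q
      exact ⟨x, ⟨hqP, fun hxU => hqU ((hmem x hqP).2 hxU)⟩, rfl⟩
    · rintro ⟨x, ⟨hxP, hxU⟩, rfl⟩
      exact ⟨hxP, fun h => hxU ((hmem x hxP).1 h)⟩

/-- The labels of the vertices that represent the points of a subset of the realization. -/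
def shadow {C : Type*} (G : TopGraph V) (f : V → C) (P : Set G.Realization) : Set C :=
  f '' (G.toRealization ⁻¹' P)

variable {Q N U W : Set G.Realization} {C : Type*} [TopologicalSpace C] {K : TopGraph C} {f : V → C}

theorem exists_isForwardPair_of_twoSheet (hG : ∀ a b c, G.Edge a b → G.Edge b c → G.Edge a c)
    (hc : IsCyclicCut P Q M N) {B : Set C} {h : V → SheetVertex B} (hh : Continuous h)
    (hbase : SheetVertex.base ∘ h = f)
    (hE : ∀ x y, G.Edge x y → (K.twoSheet (G.shadow f P) (G.shadow f Q) B).Edge (h x) (h y))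
    (hM : ∀ x, G.toRealization x ∈ M → f x ∉ B) :
    ∃ S R, IsForwardPair P Q M N S R ∧
      (∀ x, G.toRealization x ∈ P → (G.toRealization x ∈ S ↔ (h x).left = true)) ∧
      ∀ x, G.toRealization x ∈ Q → (G.toRealization x ∈ R ↔ (h x).right = true) := by
  subst hbase
  obtain ⟨S, hS, hmemS⟩ := exists_isClopenOn_realization hG hc.isClosed_left
    ((isClopen_discrete {v : SheetVertex B | v.left = true}).preimage hh) <| by
      intro x y hxy hx hxt
      have hy : G.toRealization y ∈ P := toRealization_eq_of_edge hxy ▸ hx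
      exact ((hE x y hxy).2.1 ⟨x, hx, rfl⟩ ⟨y, hy, rfl⟩).symm.trans hxt
  obtain ⟨R, hR, hmemR⟩ := exists_isClopenOn_realization hG hc.isClosed_right
    ((isClopen_discrete {v : SheetVertex B | v.right = true}).preimage hh) <| by
      intro x y hxy hx hxt
      have hy : G.toRealization y ∈ Q := toRealization_eq_of_edge hxy ▸ hx
      exact ((hE x y hxy).2.2 ⟨x, hx, rfl⟩ ⟨y, hy, rfl⟩).symm.trans hxt
  refine ⟨S, R, ⟨hS, hR, fun q hq => ?_, fun q hq hqR => ?_⟩, hmemS, hmemR⟩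
  · obtain ⟨x, rfl⟩ := G.surjective_toRealization q
    rw [hmemS x (hc.mid_subset_left hq), hmemR x (hc.mid_subset_right hq), mem_preimage,
      mem_preimage, mem_ofPred_eq, mem_ofPred_eq, (h x).left_eq_right (hM x hq)]
  · obtain ⟨x, rfl⟩ := G.surjective_toRealization q
    exact (hmemS x (hc.cut_subset_left hq)).2
      ((h x).right_le_left ((hmemR x (hc.cut_subset_right hq)).1 hqR))

variable [DiscreteTopology C]

theorem exists_reach_shadow (hG : ∀ a b c, G.Edge a b → G.Edge b c → G.Edge a c)
    (hf : Continuous f) (hE : ∀ a b, G.Edge a b → K.Edge (f a) (f b)) (hP : IsClosed P)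
    (hM : MeetsClopenSubsets M P) (hMP : M ⊆ P) {c : C} (hc : c ∈ G.shadow f P) :
    ∃ z, G.toRealization z ∈ M ∧ K.Reach (G.shadow f P) c (f z) := by
  obtain ⟨x, hx, rfl⟩ := hc
  obtain ⟨S, hS, hmemS⟩ := exists_isClopenOn_realization hG hP
    ((isClopen_discrete {c | K.Reach (G.shadow f P) (f x) c}).preimage hf) <| by
      intro y z hyz hyP hy
      have hzP : G.toRealization z ∈ P := toRealization_eq_of_edge hyz ▸ hyP
      exact ReflTransGen.tail hy ⟨hE y z hyz, z, hzP, rfl⟩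
  obtain ⟨q, hqS, hqM⟩ := hM S hS ⟨_, hx, (hmemS x hx).2 ReflTransGen.refl⟩
  obtain ⟨z, rfl⟩ := G.surjective_toRealization q
  exact ⟨z, hqM, (hmemS z (hMP hqM)).1 hqS⟩

theorem isFiniteCut_shadow (hG : ∀ a b c, G.Edge a b → G.Edge b c → G.Edge a c)
    (hf : G.IsEpi K f) (hc : IsCyclicCut P Q M N) (hUW : Disjoint U W) (hMU : M ⊆ U)
    (hcases : ∀ c ∈ G.shadow f P ∩ G.shadow f Q,
      f ⁻¹' {c} ⊆ G.toRealization ⁻¹' U ∨ f ⁻¹' {c} ⊆ G.toRealization ⁻¹' W) :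
    IsFiniteCut K (G.shadow f P) (G.shadow f Q)
      {c ∈ G.shadow f P ∩ G.shadow f Q | f ⁻¹' {c} ⊆ G.toRealization ⁻¹' W} := by
  have hmid : ∀ z, G.toRealization z ∈ M →
      f z ∉ {c ∈ G.shadow f P ∩ G.shadow f Q | f ⁻¹' {c} ⊆ G.toRealization ⁻¹' W} :=
    fun z hz h => disjoint_left.1 hUW (hMU hz) (h.2 rfl)
  refine ⟨fun c h => h.1.1, fun c h => h.1.2, fun c d hcd => ?_, fun c d hcd hcN hd => ?_,
    fun c hcP => ?_, fun c hcQ => ?_⟩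
  · obtain ⟨x, y, hxy, rfl, rfl⟩ := hf.surjective_edge c d hcd
    have heq := toRealization_eq_of_edge hxy
    have hx : G.toRealization x ∈ P ∪ Q := hc.union.ge (mem_univ _)
    exact hx.imp (fun h => ⟨⟨x, h, rfl⟩, y, (heq ▸ h : G.toRealization y ∈ P), rfl⟩)
      fun h => ⟨⟨x, h, rfl⟩, y, (heq ▸ h : G.toRealization y ∈ Q), rfl⟩
  · obtain ⟨x, y, hxy, rfl, rfl⟩ := hf.surjective_edge c d hcd
    have hyW : G.toRealization y ∈ W := toRealization_eq_of_edge hxy ▸ hcN.2 rfl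
    exact ⟨hd, (hcases _ hd).resolve_left fun h => disjoint_left.1 hUW (h rfl) hyW⟩
  · obtain ⟨z, hzM, hz⟩ := exists_reach_shadow hG hf.continuous hf.map_edge hc.isClosed_left
      hc.left_meets hc.mid_subset_left hcP
    exact ⟨f z, hmid z hzM, hz⟩
  · obtain ⟨z, hzM, hz⟩ := exists_reach_shadow hG hf.continuous hf.map_edge hc.isClosed_right
      hc.right_meets hc.mid_subset_right hcQ
    exact ⟨f z, hmid z hzM, hz⟩

end FiniteModel

end TopGraph

section NotHomogeneous

variable {V : Type*} [TopologicalSpace V] {G : TopGraph V}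

theorem IsConfluentFraisseLimit.exists_separating_isConfluentEpi (hG : IsConfluentFraisseLimit G)
    {P Q M N : Set G.Realization} (hc : IsCyclicCut P Q M N) :
    ∃ (C : Type) (_ : Finite C) (_ : TopologicalSpace C) (_ : DiscreteTopology C) (K : TopGraph C)
      (f : V → C) (U W : Set G.Realization), K.Connected ∧ G.IsConfluentEpi K f ∧
      Disjoint U W ∧ M ⊆ U ∧ N ⊆ W ∧ ∀ c ∈ G.shadow f P ∩ G.shadow f Q,
        f ⁻¹' {c} ⊆ G.toRealization ⁻¹' U ∨ f ⁻¹' {c} ⊆ G.toRealization ⁻¹' W := by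
  obtain ⟨_, -, _⟩ := hG.isContinuum_realization
  obtain ⟨U, W, hU, hW, hMU, hNW, hUW⟩ := SeparatedNhds.of_isCompact_isCompact
    hc.isClosed_mid.isCompact hc.isClosed_cut.isCompact hc.disjoint
  obtain ⟨C, _, _, _, K, f, hK, hf, hfib⟩ := hG.exists_fibres_subset
    (𝒰 := preimage G.toRealization '' {U, W, Pᶜ, Qᶜ}) (by
      rintro _ ⟨O, rfl | rfl | rfl | rfl, rfl⟩
      exacts [hU.preimage G.continuous_toRealization, hW.preimage G.continuous_toRealization,
        hc.isClosed_left.isOpen_compl.preimage G.continuous_toRealization,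
        hc.isClosed_right.isOpen_compl.preimage G.continuous_toRealization]) (by
      refine sUnion_eq_univ_iff.2 fun x => ?_
      suffices hx : ∃ O ∈ ({U, W, Pᶜ, Qᶜ} : Set (Set G.Realization)), G.toRealization x ∈ O from
        let ⟨O, hO, hxO⟩ := hx; ⟨_, mem_image_of_mem _ hO, hxO⟩
      by_cases hx : G.toRealization x ∈ P ∩ Q
      · rcases hc.inter.le hx with hxM | hxN
        exacts [⟨U, by simp, hMU hxM⟩, ⟨W, by simp, hNW hxN⟩]
      · rcases not_and_or.1 hx with hxP | hxQ
        exacts [⟨Pᶜ, by simp, hxP⟩, ⟨Qᶜ, by simp, hxQ⟩])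
  refine ⟨C, ‹_›, ‹_›, ‹_›, K, f, U, W, hK, hf, hUW, hMU, hNW, ?_⟩
  rintro _ ⟨⟨p, hp, rfl⟩, q, hq, hqp⟩
  obtain ⟨_, ⟨O, rfl | rfl | rfl | rfl, rfl⟩, hO⟩ := hfib p
  exacts [Or.inl hO, Or.inr hO, absurd hp (hO rfl), absurd hq (hO hqp)]

/-- The flow through the cut can be lifted to a two-sheeted cover; a generic vertex can be sent to
a vertex where the lift changes sheets, so that the flow enters a forward pair at that point. -/
theorem IsGenericVertex.not_isRecurrentPoint (hG : IsConfluentFraisseLimit G) {y : V}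
    (hy : IsGenericVertex G y) : ¬ IsRecurrentPoint (G.toRealization y) := by
  rintro ⟨P, Q, M, N, hc, hyN, hrec⟩
  have := hG.compactSpace
  obtain ⟨C, _, _, _, K, f, U, W, hK, hf, hUW, hMU, hNW, hcases⟩ :=
    hG.exists_separating_isConfluentEpi hc
  have hyP := hc.cut_subset_left hyN
  have hyQ := hc.cut_subset_right hyN
  have hcut := isFiniteCut_shadow hG.edge_trans hf.toIsEpi hc hUW hMU hcases
  have hfy : f y ∈ {c ∈ G.shadow f P ∩ G.shadow f Q | f ⁻¹' {c} ⊆ G.toRealization ⁻¹' W} := by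
    have hPQ : f y ∈ G.shadow f P ∩ G.shadow f Q := ⟨⟨y, hyP, rfl⟩, y, hyQ, rfl⟩
    exact ⟨hPQ, (hcases _ hPQ).resolve_left fun h => disjoint_left.1 hUW (h rfl) (hNW hyN)⟩
  obtain ⟨h, hh, hfh, hhy⟩ := hy C _ K _ (hcut.connected_twoSheet hK ⟨_, hfy⟩) f _
    (SheetVertex.passage hfy) hf (hcut.isConfluentEpi_base hK ⟨_, hfy⟩) rfl
  obtain ⟨S, R, hSR, hS, hR⟩ := exists_isForwardPair_of_twoSheet hG.edge_trans hc hh.continuous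
    hfh.symm hh.map_edge fun x hx hxN => disjoint_left.1 hUW (hMU hx) (hxN.2 rfl)
  have hyR := (hR y hyQ).1 (hrec S R hSR ((hS y hyP).2 (by rw [hhy]; rfl)))
  rw [hhy] at hyR
  exact Bool.false_ne_true hyR

theorem IsConfluentFraisseLimit.not_isHomogeneousSpace (hG : IsConfluentFraisseLimit G) :
    ¬ IsHomogeneousSpace G.Realization := by
  intro hom
  obtain ⟨x, hx⟩ := hG.exists_isRecurrentPoint
  obtain ⟨y, hy⟩ := hG.exists_isGenericVertex
  obtain ⟨e, rfl⟩ := hom (G.toRealization y) x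
  exact hy.not_isRecurrentPoint hG (hx.of_homeomorph e)

end NotHomogeneous

section ExtensionProblem

/-- An extension problem for `G` of size at most `n`: a confluent epimorphism from `G` to `target`
is to be factored through the confluent epimorphism `cover` from `source` to `target`. -/
structure ExtensionProblem {V : Type*} [TopologicalSpace V] (G : TopGraph V) (n : ℕ) where
  targetCard : Fin (n + 1)
  sourceCard : Fin (n + 1)
  target : TopGraph (Fin targetCard)
  source : TopGraph (Fin sourceCard)
  map : V → Fin targetCard
  cover : Fin sourceCard → Fin targetCard
  source_connected : source.Connected
  isConfluentEpi_map : G.IsConfluentEpi target map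
  isConfluentEpi_cover : source.IsConfluentEpi target cover

namespace ExtensionProblem

variable {V W Y : Type*} [TopologicalSpace V] [TopologicalSpace W] [TopologicalSpace Y]
  {G : TopGraph V} {H : TopGraph W} {J : TopGraph Y} {n : ℕ}

instance [Finite V] : Finite (ExtensionProblem G n) := by
  refine Finite.of_injective (fun p : ExtensionProblem G n =>
    (⟨p.targetCard, p.sourceCard, p.target, p.source, p.map, p.cover⟩ :
      Σ a b : Fin (n + 1), TopGraph (Fin a) × TopGraph (Fin b) × (V → Fin a) × (Fin b → Fin a))) ?_
  rintro ⟨⟩ ⟨⟩ h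
  cases h
  rfl

/-- The extension problem has a solution after composition with `π`. -/
def IsSolvedBy (p : ExtensionProblem G n) (H : TopGraph W) (π : W → V) : Prop :=
  ∃ h, H.IsConfluentEpi p.source h ∧ p.map ∘ π = p.cover ∘ h

theorem IsSolvedBy.comp {p : ExtensionProblem G n} {π : W → V} {q : Y → W}
    (hp : p.IsSolvedBy H π) (hq : J.IsConfluentEpi H q) : p.IsSolvedBy J (π ∘ q) := by
  obtain ⟨h, hh, hph⟩ := hp
  exact ⟨h ∘ q, hh.comp hq, congrArg (· ∘ q) hph⟩

end ExtensionProblem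

/-- A finite connected graph, with its set of vertices. -/
structure FiniteConnectedGraph where
  Vertex : Type
  [topology : TopologicalSpace Vertex]
  [discrete : DiscreteTopology Vertex]
  [finite : Finite Vertex]
  graph : TopGraph Vertex
  connected : graph.Connected

namespace FiniteConnectedGraph

attribute [instance] topology discrete finite

/-- The graph with a single vertex. -/
def point : FiniteConnectedGraph where
  Vertex := Unit
  graph := ⟨fun _ _ => True, fun _ => trivial, fun _ _ _ => trivial, isClosed_discrete _⟩
  connected := connected_of_forall_reach (a := ()) fun _ => ReflTransGen.refl

theorem isConfluentEpi_point {B : Type*} [TopologicalSpace B] [DiscreteTopology B] {L : TopGraph B}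
    (hL : L.Connected) : L.IsConfluentEpi point.graph fun _ => () :=
  have := hL.1
  LiftsEdges.isConfluentEpi (fun a _ _ => ⟨a, ReflTransGen.refl, rfl⟩) point.connected
    fun _ _ _ => trivial

variable {X Y : FiniteConnectedGraph} {n : ℕ}

theorem exists_isSolvedBy {π : Y.Vertex → X.Vertex} (hπ : Y.graph.IsConfluentEpi X.graph π)
    (p : ExtensionProblem X.graph n) :
    ∃ (Z : FiniteConnectedGraph) (q : Z.Vertex → Y.Vertex),
      Z.graph.IsConfluentEpi Y.graph q ∧ p.IsSolvedBy Z.graph (π ∘ q) := by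
  obtain ⟨y⟩ := Y.connected.1
  obtain ⟨b, hb⟩ := p.isConfluentEpi_cover.surjective (p.map (π y))
  obtain ⟨D, _, _, _, N, q, h, -, hN, hq, hh, hqh, -, -⟩ :=
    exists_amalgam Y.connected p.source_connected (p.isConfluentEpi_map.comp hπ)
      p.isConfluentEpi_cover (b := y) (c := b) hb.symm
  exact ⟨⟨D, N, hN⟩, q, hq, h, hh, hqh⟩

theorem exists_forall_isSolvedBy (X : FiniteConnectedGraph) (n : ℕ) :
    ∃ (Y : FiniteConnectedGraph) (π : Y.Vertex → X.Vertex), Y.graph.IsConfluentEpi X.graph π ∧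
      ∀ p : ExtensionProblem X.graph n, p.IsSolvedBy Y.graph π := by
  suffices h : ∀ s : Set (ExtensionProblem X.graph n), s.Finite →
      ∃ (Y : FiniteConnectedGraph) (π : Y.Vertex → X.Vertex), Y.graph.IsConfluentEpi X.graph π ∧
        ∀ p ∈ s, p.IsSolvedBy Y.graph π by
    simpa using h univ (toFinite _)
  intro s hs
  induction s, hs using Set.Finite.induction_on with
  | empty => exact ⟨X, id, X.graph.isConfluentEpi_id, by simp⟩
  | @insert p s _ _ ih =>
    obtain ⟨Y, π, hπ, hY⟩ := ih
    obtain ⟨Z, q, hq, hZ⟩ := exists_isSolvedBy hπ p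
    exact ⟨Z, π ∘ q, hπ.comp hq, forall_mem_insert.2 ⟨hZ, fun r hr => (hY r hr).comp hq⟩⟩

theorem exists_genericSequence :
    ∃ (X : ℕ → FiniteConnectedGraph) (π : ∀ n, (X (n + 1)).Vertex → (X n).Vertex),
      ∀ n, (X (n + 1)).graph.IsConfluentEpi (X n).graph (π n) ∧
        ∀ p : ExtensionProblem (X n).graph n, p.IsSolvedBy (X (n + 1)).graph (π n) := by
  choose Y π hY using exists_forall_isSolvedBy
  exact ⟨Nat.rec point fun n X => Y X n, fun n => π _ n, fun n => hY _ n⟩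

end FiniteConnectedGraph

end ExtensionProblem

/-- The threads of an inverse sequence. -/
abbrev InverseLimit {A : ℕ → Type*} (π : ∀ n, A (n + 1) → A n) : Type _ :=
  {x : ∀ n, A n // ∀ n, π n (x (n + 1)) = x n}

namespace InverseLimit

section Threads

/-- The projection of an inverse limit to a member of the sequence. -/
def proj {A : ℕ → Type*} (π : ∀ n, A (n + 1) → A n) (n : ℕ) (x : InverseLimit π) : A n :=
  x.1 n

theorem map_proj {A : ℕ → Type*} {π : ∀ n, A (n + 1) → A n} (x : InverseLimit π) (n : ℕ) :
    π n (proj π (n + 1) x) = proj π n x :=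
  x.2 n

theorem exists_thread {A : ℕ → Type*} {π : ∀ n, A (n + 1) → A n} {C : ∀ n, Set (A n)} {n : ℕ}
    (hC : ∀ m ≥ n, SurjOn (π m) (C (m + 1)) (C m)) {c : A n} (hc : c ∈ C n) :
    ∃ x : InverseLimit π, proj π n x = c ∧ ∀ m ≥ n, proj π m x ∈ C m := by
  induction n generalizing A with
  | zero =>
    have hex (m : ℕ) (c : C m) : ∃ d : C (m + 1), π m d = c := by
      simpa using hC m (Nat.zero_le m) c.2
    choose lift hlift using hex
    let x : ∀ m, C m := Nat.rec ⟨c, hc⟩ lift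
    let y : InverseLimit π := ⟨fun m => (x m).1, fun m => hlift m (x m)⟩
    exact ⟨y, rfl, fun m _ => (x m).2⟩
  | succ n ih =>
    obtain ⟨x, hxc, hxC⟩ := ih (π := fun m => π (m + 1)) (C := fun m => C (m + 1))
      (fun m hm => hC (m + 1) (Nat.succ_le_succ hm)) hc
    let y : ∀ m, A m := fun m => m.casesOn (π 0 (x.1 0)) x.1
    refine ⟨⟨y, fun m => ?_⟩, hxc, fun m hm => ?_⟩
    · cases m with
      | zero => rfl
      | succ m => exact x.2 m
    · cases m with
      | zero => exact absurd hm (Nat.not_succ_le_zero n)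
      | succ m => exact hxC m (Nat.le_of_succ_le_succ hm)

variable {A : ℕ → Type*} {π : ∀ n, A (n + 1) → A n}

theorem surjective_proj (hπ : ∀ n, Function.Surjective (π n)) (n : ℕ) :
    Function.Surjective (proj π n) := fun c => by
  obtain ⟨x, hx, -⟩ := exists_thread (π := π) (C := fun _ => univ)
    (fun m _ => surjOn_univ.2 (hπ m)) (mem_univ c)
  exact ⟨x, hx⟩

theorem rel_of_le {R : ∀ n, A n → A n → Prop}
    (hR : ∀ n a b, R (n + 1) a b → R n (π n a) (π n b)) {x y : InverseLimit π} {m n : ℕ}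
    (hmn : m ≤ n) (h : R n (proj π n x) (proj π n y)) : R m (proj π m x) (proj π m y) := by
  induction n, hmn using Nat.le_induction with
  | base => exact h
  | succ n _ ih =>
    rw [← map_proj x, ← map_proj y] at ih
    exact ih (hR n _ _ h)

theorem proj_eq_of_le {x y : InverseLimit π} {m n : ℕ} (hmn : m ≤ n)
    (h : proj π n x = proj π n y) : proj π m x = proj π m y :=
  rel_of_le (R := fun _ a b => a = b) (fun n _ _ => congrArg (π n)) hmn h

end Threads

section Compactness

variable {A : ℕ → Type*} {π : ∀ n, A (n + 1) → A n} [∀ n, TopologicalSpace (A n)]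

theorem continuous_proj (n : ℕ) : Continuous (proj π n) :=
  (continuous_apply n).comp continuous_subtype_val

variable [∀ n, DiscreteTopology (A n)]

theorem isClosed_rel (R : ∀ n, A n → A n → Prop) (n : ℕ) :
    IsClosed {p : InverseLimit π × InverseLimit π | R n (proj π n p.1) (proj π n p.2)} :=
  (isClosed_discrete {q : A n × A n | R n q.1 q.2}).preimage
    ((continuous_proj n).prodMap (continuous_proj n))

variable [∀ n, Finite (A n)]

instance : CompactSpace (InverseLimit π) := by
  have hclosed : IsClosed {x : ∀ n, A n | ∀ n, π n (x (n + 1)) = x n} := by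
    simp only [ofPred_forall]
    exact isClosed_iInter fun n => isClosed_eq
      (continuous_of_discreteTopology.comp (continuous_apply _)) (continuous_apply _)
  exact isCompact_iff_compactSpace.1 hclosed.isCompact

instance : SecondCountableTopology (InverseLimit π) :=
  TopologicalSpace.Subtype.secondCountableTopology {x : ∀ n, A n | ∀ n, π n (x (n + 1)) = x n}

theorem exists_forall_rel {R : ∀ n, A n → A n → Prop}
    (hR : ∀ n a b, R (n + 1) a b → R n (π n a) (π n b))
    {Z : Set (InverseLimit π × InverseLimit π)} (hZ : IsClosed Z)
    (h : ∀ n, ∃ p ∈ Z, R n (proj π n p.1) (proj π n p.2)) :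
    ∃ p ∈ Z, ∀ n, R n (proj π n p.1) (proj π n p.2) := by
  let T (n : ℕ) : Set (InverseLimit π × InverseLimit π) :=
    Z ∩ {p | R n (proj π n p.1) (proj π n p.2)}
  have hT (n : ℕ) : IsClosed (T n) := hZ.inter (isClosed_rel R n)
  obtain ⟨p, hp⟩ := IsCompact.nonempty_iInter_of_sequence_nonempty_isCompact_isClosed T
    (fun n p hp => ⟨hp.1, rel_of_le hR (Nat.le_succ n) hp.2⟩) h (hT 0).isCompact hT
  rw [mem_iInter] at hp
  exact ⟨p, (hp 0).1, fun n => (hp n).2⟩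

theorem exists_notMem_of_proj_eq {Z : Set (InverseLimit π × InverseLimit π)} (hZ : IsClosed Z)
    (hdiag : ∀ x, (x, x) ∉ Z) : ∃ n, ∀ x y, proj π n x = proj π n y → (x, y) ∉ Z := by
  by_contra! hcon
  obtain ⟨⟨x, y⟩, hxy, heq⟩ := exists_forall_rel (R := fun _ a b => a = b)
    (fun n _ _ => congrArg (π n)) hZ fun n =>
      let ⟨x, y, hxy, h⟩ := hcon n; ⟨(x, y), h, hxy⟩
  obtain rfl : x = y := Subtype.ext (funext heq)
  exact hdiag x hxy

end Compactness

section Component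

variable {A : ℕ → Type*} [∀ n, TopologicalSpace (A n)] {X : ∀ n, TopGraph (A n)}
  {π : ∀ n, A (n + 1) → A n}

theorem image_component_image_proj (hπ : ∀ n, (X (n + 1)).IsConfluentEpi (X n) (π n)) {n m : ℕ}
    (hnm : n ≤ m) (Q : Set (A n)) {a : InverseLimit π} (ha : proj π n a ∈ Q) :
    π m '' (X (m + 1)).component (proj π (m + 1) '' (proj π n ⁻¹' Q)) (proj π (m + 1) a) =
      (X m).component (proj π m '' (proj π n ⁻¹' Q)) (proj π m a) := by
  have hpre : proj π (m + 1) '' (proj π n ⁻¹' Q) = π m ⁻¹' (proj π m '' (proj π n ⁻¹' Q)) := by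
    ext c
    constructor
    · rintro ⟨x, hx, rfl⟩
      exact ⟨x, hx, (map_proj x m).symm⟩
    · rintro ⟨x, hx, hxc⟩
      obtain ⟨y, rfl⟩ := surjective_proj (π := π) (fun n => (hπ n).surjective) (m + 1) c
      have hxy : proj π n x = proj π n y := proj_eq_of_le hnm (hxc.trans (map_proj y m))
      exact ⟨y, (hxy ▸ hx : proj π n y ∈ Q), rfl⟩
  have ham : π m (proj π (m + 1) a) = proj π m a := map_proj a m
  rw [hpre, (hπ m).image_component (ham ▸ mem_image_of_mem _ ha), ham]

end Component

section Graph

variable {A : ℕ → Type*} [∀ n, TopologicalSpace (A n)] [∀ n, DiscreteTopology (A n)]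
  {X : ∀ n, TopGraph (A n)} {π : ∀ n, A (n + 1) → A n}

/-- The inverse limit of a sequence of graphs. -/
def graph (X : ∀ n, TopGraph (A n)) (π : ∀ n, A (n + 1) → A n) : TopGraph (InverseLimit π) where
  Edge x y := ∀ n, (X n).Edge (proj π n x) (proj π n y)
  refl _ n := (X n).refl _
  symm _ _ h n := (X n).symm _ _ (h n)
  closed := by
    simp only [ofPred_forall]
    exact isClosed_iInter (isClosed_rel fun n => (X n).Edge)

theorem isEpi_proj (hπ : ∀ n, (X (n + 1)).IsEpi (X n) (π n)) (n : ℕ) :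
    (graph X π).IsEpi (X n) (proj π n) where
  continuous := continuous_proj n
  map_edge _ _ h := h n
  surjective := surjective_proj (fun n => (hπ n).surjective) n
  surjective_edge c d hcd := by
    obtain ⟨z, hz, hedge⟩ := exists_thread (π := fun n => Prod.map (π n) (π n))
      (C := fun n => {p : A n × A n | (X n).Edge p.1 p.2}) (n := n) (c := (c, d))
      (fun m _ p hp => by
        obtain ⟨a, b, hab, ha, hb⟩ := (hπ m).surjective_edge _ _ hp
        exact ⟨(a, b), hab, Prod.ext ha hb⟩) hcd
    let x : InverseLimit π := ⟨fun m => (z.1 m).1, fun m => congrArg Prod.fst (z.2 m)⟩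
    let y : InverseLimit π := ⟨fun m => (z.1 m).2, fun m => congrArg Prod.snd (z.2 m)⟩
    refine ⟨x, y, fun m => ?_, congrArg Prod.fst hz, congrArg Prod.snd hz⟩
    exact rel_of_le (R := fun n => (X n).Edge) (fun n => (hπ n).map_edge) (le_max_left m n)
      (hedge _ (le_max_right m n))

variable [∀ n, Finite (A n)]

theorem connectedSet_of_image_proj
    (hE : ∀ n a b, (X (n + 1)).Edge a b → (X n).Edge (π n a) (π n b)) {L : Set (InverseLimit π)}
    (hL : IsClosed L) {n : ℕ} (hconn : ∀ m ≥ n, (X m).ConnectedSet (proj π m '' L)) :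
    (graph X π).ConnectedSet L := by
  refine connectedSet_iff.2 fun U hU hUE ⟨x, hxL, hxU⟩ y hyL => ?_
  by_contra hyU
  obtain ⟨hinter, hdiff⟩ := (isClopenOn_iff hL).1 hU
  suffices hedges : ∀ m, ∃ p ∈ (L ∩ U) ×ˢ (L \ U), (X m).Edge (proj π m p.1) (proj π m p.2) by
    obtain ⟨p, hp, hedge⟩ := exists_forall_rel (R := fun n => (X n).Edge) hE
      (hinter.prod hdiff) hedges
    exact hp.2.2 (hUE p.1 hp.1 p.2 hp.2.1 hedge)
  intro m
  suffices hmax : ∃ p ∈ (L ∩ U) ×ˢ (L \ U), (X (max m n)).Edge (proj π _ p.1) (proj π _ p.2) from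
    hmax.imp fun p hp => ⟨hp.1, rel_of_le (R := fun n => (X n).Edge) hE (le_max_left m n) hp.2⟩
  by_contra! hcon
  obtain ⟨z, hz, hzy⟩ := (hconn _ (le_max_right m n)).subset_of_isClopenOn
    (U := proj π _ '' (L ∩ U)) ((isClopen_discrete _).preimage continuous_subtype_val) (by
      rintro _ ⟨-, u, hu, rfl⟩ _ ⟨v, hv, rfl⟩ huv
      by_contra hvU
      exact hcon (u, v) ⟨hu, hv, fun h => hvU ⟨v, ⟨hv, h⟩, rfl⟩⟩ huv)
    ⟨_, ⟨x, hxL, rfl⟩, x, ⟨hxL, hxU⟩, rfl⟩ ⟨y, hyL, rfl⟩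
  exact hcon (z, y) ⟨hz, hyL, hyU⟩ (hzy ▸ (X _).refl _)

/-- The component of the preimage of `Q` is the limit of the components at the later stages. -/
theorem isConfluentEpi_proj (hπ : ∀ n, (X (n + 1)).IsConfluentEpi (X n) (π n)) (n : ℕ) :
    (graph X π).IsConfluentEpi (X n) (proj π n) where
  toIsEpi := isEpi_proj (fun n => (hπ n).toIsEpi) n
  confluent Q hQ a ha := by
    let C (m : ℕ) : Set (A m) :=
      (X m).component (proj π m '' (proj π n ⁻¹' Q)) (proj π m a)
    let L : Set (InverseLimit π) := {x | ∀ m ≥ n, proj π m x ∈ C m}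
    have hCn : C n = Q := by
      have hs := surjective_proj (π := π) (fun n => (hπ n).surjective) n
      simp only [C, image_preimage_eq Q hs]
      exact (component_subset _ _ _).antisymm (hQ.subset_component Subset.rfl ha)
    have hC (m : ℕ) (hm : m ≥ n) : π m '' C (m + 1) = C m := image_component_image_proj hπ hm Q ha
    have himage (m : ℕ) (hm : m ≥ n) : proj π m '' L = C m := by
      refine Subset.antisymm (image_subset_iff.2 fun x hx => hx m hm) fun c hc => ?_
      obtain ⟨x, hxc, hx⟩ := exists_thread (fun k hk => (hC k (hm.trans hk)).ge) hc
      refine ⟨x, fun k hk => ?_, hxc⟩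
      exact rel_of_le (y := x) (R := fun j c _ => n ≤ j → c ∈ C j)
        (fun j b _ hb hj => (hC j hj).le ⟨b, hb (Nat.le_succ_of_le hj), rfl⟩) (le_max_left k m)
        (fun _ => hx _ (le_max_right k m)) hk
    have hL : IsClosed L := by
      simp only [L, ofPred_forall]
      exact isClosed_iInter fun m => isClosed_iInter fun _ =>
        (isClosed_discrete (C m)).preimage (continuous_proj m)
    have hLconn : (graph X π).ConnectedSet L :=
      connectedSet_of_image_proj (fun n => (hπ n).map_edge) hL
        fun m hm => himage m hm ▸ connectedSet_component _ _ _
    have haL : a ∈ L := fun m _ => mem_component_self _ (mem_image_of_mem _ ha)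
    refine Subset.antisymm (image_subset_iff.2 (component_subset _ _ a)) ?_
    calc Q = proj π n '' L := ((himage n le_rfl).trans hCn).symm
      _ ⊆ _ := image_mono (hLconn.subset_component (fun x hx => hCn ▸ hx n le_rfl) haL)

end Graph

section GenericSequence

variable {A : ℕ → Type*} [∀ n, TopologicalSpace (A n)] [∀ n, DiscreteTopology (A n)]
  [∀ n, Finite (A n)] {X : ∀ n, TopGraph (A n)} {π : ∀ n, A (n + 1) → A n} {B C : Type*}
  [TopologicalSpace B] [TopologicalSpace C] [DiscreteTopology B] {K : TopGraph B} {L : TopGraph C}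

theorem exists_factorization (hπ : ∀ n, (X (n + 1)).IsConfluentEpi (X n) (π n))
    {f : InverseLimit π → B} (hf : (graph X π).IsConfluentEpi K f) :
    ∃ n, ∀ N ≥ n, ∃ σ : A N → B, (X N).IsConfluentEpi K σ ∧ σ ∘ proj π N = f := by
  obtain ⟨n, hn⟩ := exists_notMem_of_proj_eq (π := π) (Z := {p | f p.1 ≠ f p.2})
    ((isClosed_discrete {q : B × B | q.1 ≠ q.2}).preimage (hf.continuous.prodMap hf.continuous))
    fun x h => h rfl
  refine ⟨n, fun N hN => ?_⟩
  have hproj := (isConfluentEpi_proj hπ N).toIsEpi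
  let σ : A N → B := f ∘ Function.surjInv hproj.surjective
  have hσ : σ ∘ proj π N = f := funext fun x =>
    not_not.1 (hn _ _ (proj_eq_of_le hN (Function.surjInv_eq hproj.surjective _)))
  exact ⟨σ, .of_comp continuous_of_discreteTopology (hσ ▸ hf) hproj, hσ⟩

theorem exists_extension [Finite B] [Finite C] [DiscreteTopology C]
    (hπ : ∀ n, (X (n + 1)).IsConfluentEpi (X n) (π n))
    (hsolve : ∀ n (p : ExtensionProblem (X n) n), p.IsSolvedBy (X (n + 1)) (π n))
    (hL : L.Connected) {f : InverseLimit π → B} {g : C → B}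
    (hf : (graph X π).IsConfluentEpi K f) (hg : L.IsConfluentEpi K g) :
    ∃ h : InverseLimit π → C, (graph X π).IsConfluentEpi L h ∧ f = g ∘ h := by
  obtain ⟨n, hn⟩ := exists_factorization hπ hf
  obtain ⟨b, ⟨e⟩⟩ := exists_homeomorph_fin B
  obtain ⟨c, ⟨e'⟩⟩ := exists_homeomorph_fin C
  let N := max n (max b c)
  obtain ⟨σ, hσ, rfl⟩ := hn N (le_max_left _ _)
  let p : ExtensionProblem (X N) N :=
    { targetCard := ⟨b, by omega⟩
      sourceCard := ⟨c, by omega⟩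
      target := K.transport e
      source := L.transport e'
      map := e ∘ σ
      cover := e ∘ g ∘ e'.symm
      source_connected := hL.transport e'
      isConfluentEpi_map := (K.isConfluentEpi_transport e).comp hσ
      isConfluentEpi_cover :=
        (K.isConfluentEpi_transport e).comp (hg.comp (L.isConfluentEpi_transport_symm e')) }
  obtain ⟨h, hh, hσh⟩ := hsolve N p
  refine ⟨e'.symm ∘ h ∘ proj π (N + 1),
    (L.isConfluentEpi_transport_symm e').comp (hh.comp (isConfluentEpi_proj hπ (N + 1))), ?_⟩
  funext x
  have hx : e (σ (π N (proj π (N + 1) x))) = e (g (e'.symm (h (proj π (N + 1) x)))) :=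
    congrFun hσh _
  rw [map_proj (π := π)] at hx
  exact e.injective hx

theorem isConfluentFraisseLimit_graph {A : ℕ → Type} [∀ n, TopologicalSpace (A n)]
    [∀ n, DiscreteTopology (A n)] [∀ n, Finite (A n)] {X : ∀ n, TopGraph (A n)}
    {π : ∀ n, A (n + 1) → A n} (hX : ∀ n, (X n).Connected)
    (hπ : ∀ n, (X (n + 1)).IsConfluentEpi (X n) (π n))
    (hsolve : ∀ n (p : ExtensionProblem (X n) n), p.IsSolvedBy (X (n + 1)) (π n)) :
    IsConfluentFraisseLimit (graph X π) where
  compactSpace := inferInstance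
  t2Space := inferInstance
  totallyDisconnectedSpace := inferInstance
  secondCountableTopology := inferInstance
  projective_universal B _ _ _ K hK := by
    obtain ⟨h, hh, -⟩ := exists_extension hπ hsolve hK
      ((FiniteConnectedGraph.isConfluentEpi_point (hX 0)).comp (isConfluentEpi_proj hπ 0))
      (FiniteConnectedGraph.isConfluentEpi_point hK)
    exact ⟨h, hh⟩
  extension _ _ _ _ _ _ _ _ _ _ _ hL _ _ hf hg := exists_extension hπ hsolve hL hf hg
  approximation m hm ε hε := by
    have hdist := @continuous_dist _ m.toPseudoMetricSpace
    rw [hm] at hdist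
    obtain ⟨n, hn⟩ := exists_notMem_of_proj_eq (π := π) (Z := {p | ε / 2 ≤ m.dist p.1 p.2})
      (isClosed_le continuous_const hdist)
      fun x h => (half_pos hε).not_ge (h.trans_eq (m.dist_self x))
    refine ⟨A n, inferInstance, inferInstance, inferInstance, X n, proj π n,
      hX n, isConfluentEpi_proj hπ n, fun c => ?_⟩
    have hdiam : @Metric.diam _ m.toPseudoMetricSpace (proj π n ⁻¹' {c}) ≤ ε / 2 :=
      @Metric.diam_le_of_forall_dist_le _ _ m.toPseudoMetricSpace _ (half_pos hε).le
        fun x hx y hy => (not_le.1 (hn x y (hx.trans hy.symm))).le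
    exact hdiam.trans_lt (half_lt_self hε)

end GenericSequence

end InverseLimit

theorem exists_isConfluentFraisseLimit :
    ∃ (V : Type) (_ : TopologicalSpace V) (G : TopGraph V), IsConfluentFraisseLimit G := by
  obtain ⟨X, π, hX⟩ := FiniteConnectedGraph.exists_genericSequence
  exact ⟨_, _, _, InverseLimit.isConfluentFraisseLimit_graph (X := fun n => (X n).graph)
    (fun n => (X n).connected) (fun n => (hX n).1) fun n => (hX n).2⟩

theorem theorem9p1 :
    (∃ (V : Type) (_ : TopologicalSpace V) (G : TopGraph V), IsConfluentFraisseLimit G) ∧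
    ∀ (V : Type u) [TopologicalSpace V] (G : TopGraph V), IsConfluentFraisseLimit G →
      (∀ a b c : V, G.Edge a b → G.Edge b c → G.Edge a c) ∧
      IsContinuum G.Realization ∧
      ¬ IsHomogeneousSpace G.Realization :=
  ⟨exists_isConfluentFraisseLimit, fun _ _ _ hG =>
    ⟨hG.edge_trans, hG.isContinuum_realization, hG.not_isHomogeneousSpace⟩⟩
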